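/- All graphs are finite, simple and undirected, and $\log$ is the natural logarithm. In the game of Cops and Robbers on a graph $G$ with $k$ cops, the cops first occupy $k$ vertices (not necessarily distinct), then the robber chooses a vertex, and then the cops and the robber move alternately, the cops first; in a move, each of the cops (respectively the robber) stays or goes to an adjacent vertex. Everybody sees all positions. The cops win if some cop eventually occupies the same vertex as the robber. The cop number $c(G)$ is the least $k$ for which $k$ cops have a winning strategy. For a set $V'$ of vertices, $S(V',r)$ and $N(V',r)$ denote the sets of vertices at distance exactly $r$, respectively at most $r$, from $V'$; $S(v,r)=S(\{v\},r)$ and $N(v,r)=N(\{v\},r)$. Given $n=|V(G)|$ and a real number $d$, a set $U\subseteq V(G)$ is $(t,c_1,c_2)$-accessible if there is a family $\{W(w):w\in U\}$ of pairwise disjoint subsets of $V(G)$ such that, for each $w\in U$, $W(w)\subseteq N(w,t)$ and $$|W(w)|\ge c_1\min\Big\{d^t,\frac{c_2n}{|U|}\Big\}.$$ **Theorem.** Let $J$ and $K$ be real constants and let $\delta,a_1,\dots,a_5$ be positive constants. There is a constant $C>0$, depending only on these constants, such that the following holds for all $n$ and all real $d$ with $2\le d<\log^J n$. Let $G$ be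 a graph on $n$ vertices, and suppose that there is a set $X\subseteq V(G)$ with $|X|\le K\sqrt n$ such that: (i) For all $v\in V(G)\setminus X$, all integers $r,r'\ge 1$ with $d^r<n^{1/2+\delta}$ and $d^{r'}<n^{1/2+\delta}$, and all $V'\subseteq N(v,r)\setminus X$ with $|V'|=k$ such that $kd^{r'}\le n/\log^J n$, $$a_1kd^{r'}\le |S(V',r')|\le a_2kd^{r'}.$$ (ii) For all integers $r,r'\ge 0$ with $n^{1/4-\delta}<(d+1)d^r<n^{1/4+\delta}$ and $n^{1/4-\delta}<(d+1)d^{r'}<n^{1/4+\delta}$, all $v\in V(G)\setminus X$ and all $A\subseteq S(v,r)\setminus X$, if $U=\bigcup_{a\in A}S(a,r')$ and if $|A|>n^{1/4-\delta}$ and $d^{r+r'}<a_3n/|U|$, then there is a set $Q$ such that $|S(a,r')\cap Q|<n^{1/4-2\delta}$ for all $a\in A$ and such that $U\setminus Q$ is $(r+r'+1,a_4,a_5)$-accessible. (iii) All vertices of $V(G)\setminus X$ lie in one component of $G$. Then $c(G)\le C\sqrt n$. -/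

import Mathlib

namespace CopsRobber

/-- The distance from the set `S` to the vertex `u`: the least length of a path of `G` from a
vertex of `S` to `u`, and `⊤` if there is none (in particular if `S` is empty). -/
noncomputable def setDist {V : Type*} (G : SimpleGraph V) (S : Set V) (u : V) : ℕ∞ :=
  ⨅ v ∈ S, G.edist v u

/-- `S(S, r)`: the vertices at distance exactly `r` from the set `S`. -/
def sphere {V : Type*} (G : SimpleGraph V) (S : Set V) (r : ℕ) : Set V :=
  {u | setDist G S u = (r : ℕ∞)}

/-- `N(S, r)`: the vertices at distance at most `r` from the set `S`. -/
def ball {V : Type*} (G : SimpleGraph V) (S : Set V) (r : ℕ) : Set V :=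
  {u | setDist G S u ≤ (r : ℕ∞)}

/-- `U` is `(t, c₁, c₂)`-accessible in the finite graph `G` with respect to the parameter `d`:
there are pairwise disjoint sets `W w ⊆ N(w, t)`, for `w ∈ U`, each of size at least
`c₁ * min (d ^ t) (c₂ * n / |U|)`, where `n` is the number of vertices. -/
def Accessible {V : Type*} (G : SimpleGraph V) (d : ℝ) (t : ℕ) (c₁ c₂ : ℝ) (U : Set V) : Prop :=
  ∃ W : V → Set V,
    U.PairwiseDisjoint W ∧
    ∀ w ∈ U, W w ⊆ ball G {w} t ∧
      c₁ * min (d ^ t) (c₂ * (Nat.card V : ℝ) / (U.ncard : ℝ)) ≤ ((W w).ncard : ℝ)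

/-- A legal move of a cop or of the robber: stay, or go along an edge. -/
def Move {V : Type*} (G : SimpleGraph V) (x y : V) : Prop := x = y ∨ G.Adj x y

/-- The robber's positions before time `t`, the most recent first. -/
def history {V : Type*} (ρ : ℕ → V) : ℕ → List V
  | 0 => []
  | t + 1 => ρ t :: history ρ t

/-- `k` cops have a winning strategy on `G`.

A strategy `σ` tells the positions of the cops as a function of all the positions of the robber so
far (most recent first): `σ []` is the initial position of the cops, chosen before the robber
chooses his vertex `ρ 0`; then, for `t = 0, 1, 2, …`, the cops move from `σ (history ρ t)` to
`σ (history ρ (t + 1))`, seeing the robber on `ρ t`, and after that the robber moves to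
`ρ (t + 1)`. The strategy wins if against every legal play `ρ` of the robber some cop is eventually
on the robber's vertex, either because the robber comes to the cop (`σ (history ρ t) i = ρ t`) or
because the cop comes to the robber (`σ (history ρ (t + 1)) i = ρ t`). -/
def CopsWin {V : Type*} (G : SimpleGraph V) (k : ℕ) : Prop :=
  ∃ σ : List V → Fin k → V,
    (∀ (h : List V) (x : V) (i : Fin k), Move G (σ h i) (σ (x :: h) i)) ∧
    ∀ ρ : ℕ → V, (∀ t, Move G (ρ t) (ρ (t + 1))) →
      ∃ (t : ℕ) (i : Fin k), σ (history ρ t) i = ρ t ∨ σ (history ρ (t + 1)) i = ρ t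

/-- A cop on each vertex wins, so that the minimum in the definition of the cop number exists. -/
theorem copsWin_card {V : Type*} [Finite V] (G : SimpleGraph V) : CopsWin G (Nat.card V) :=
  ⟨fun _ i => (Finite.equivFin V).symm i, fun _ _ _ => Or.inl rfl,
    fun ρ _ => ⟨0, Finite.equivFin V (ρ 0), Or.inl (by simp)⟩⟩

/-- The cop number `c(G)`: the least number of cops that have a winning strategy. -/
noncomputable def copNumber {V : Type*} (G : SimpleGraph V) : ℕ := sInf {k | CopsWin G k}

end CopsRobber

open CopsRobber

/-! Write `q` for n^{1/4}, so that O(q²) cops are available, and let `y` be a tiny power of n that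
absorbs d, the constants and the logarithms. The cops play in rounds. When round i starts with the
robber on v, cops are within r + 1 moves of distinct places covering the sphere S(v, r), except for
X, which is guarded permanently, and a set A of at most a₂ d^r / 4^i vertices. One team of about q²
cops heads for the inside of the ball, so the robber is caught unless he leaves it, which takes at
least r moves. He then has to emerge on some b in A, as elsewhere on the sphere he is captured at
once.

At the start of the round another team already sets out for U, the union of the spheres S(a, r')
with a in A, at distance r + r' + 1. When the robber reaches b, this team is within r' + 1 of its
targets, as the next round requires. It has to leave at most a₂ d^{r'} / 4^{i+1} vertices of each
S(a, r') uncovered (`exists_round_team`). The radii satisfy d^{r+r'} ≈ q² 2^i. Since |A| has shrunk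
by 4^i, |U| is O(q² / 2^i), and accessibility yields disjoint sets W(w) of order q² 2^i. A random
team of order (3/4)^i q² cops hits W(w) about 6 (3/2)^i times in the mean, which beats the entropy
of the choice of missed targets. The team sizes form a convergent geometric series.

The teams are fixed before the game. A position (v, A) in round i is determined by the robber's
vertices at the starts of the rounds, so there are at most n^{i+1} of them and a union bound applies
(`exists_teams`). Once |A| ≤ d^r / y^5, one more random team, which satisfies Hall's condition for
all small sets (`exists_hall_team`), covers all of U outside X, and the game ends (`wins_of_small`).
-/

namespace CopsRobber

/-! ### Winning positions, and the reduction of a round to a choice of targets. -/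

section Game

variable {V : Type*} {G : SimpleGraph V} {ι : Type*}

/-- The cops on `c`, being on the move, can catch the robber on `v` within `N` moves. -/
def WinIn (G : SimpleGraph V) : ℕ → (ι → V) → V → Prop
  | 0, c, v => ∃ i, c i = v
  | N + 1, c, v => ∃ c' : ι → V, (∀ i, Move G (c i) (c' i)) ∧
      ((∃ i, c' i = v) ∨ ∀ v', Move G v v' → WinIn G N c' v')

/-- The cops on `c`, being on the move, can catch the robber on `v`. -/
def Wins (G : SimpleGraph V) (c : ι → V) (v : V) : Prop := ∃ N, WinIn G N c v

theorem WinIn.succ : ∀ {N : ℕ} {c : ι → V} {v : V}, WinIn G N c v → WinIn G (N + 1) c v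
  | 0, c, _, h => ⟨c, fun _ => Or.inl rfl, Or.inl h⟩
  | _ + 1, _, _, ⟨c', hc', h⟩ => ⟨c', hc', h.imp_right fun h v' hv' => (h v' hv').succ⟩

theorem WinIn.mono {N M : ℕ} (hNM : N ≤ M) {c : ι → V} {v : V} (h : WinIn G N c v) :
    WinIn G M c v := by
  induction hNM with
  | refl => exact h
  | step _ ih => exact ih.succ

theorem Wins.caught {c : ι → V} {v : V} (i : ι) (h : c i = v) : Wins G c v := ⟨0, i, h⟩

theorem Wins.capture [DecidableEq ι] {c : ι → V} {v : V} (i : ι) (h : Move G (c i) v) :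
    Wins G c v := by
  refine ⟨1, Function.update c i v, fun j => ?_, Or.inl ⟨i, by simp⟩⟩
  by_cases hj : j = i
  · subst hj; simpa using h
  · simp [hj, Move]

/-- The robber has finitely many replies, so the numbers of moves needed after them have a common
bound. -/
theorem Wins.step [Finite V] {c c' : ι → V} {v : V} (hc : ∀ i, Move G (c i) (c' i))
    (h : ∀ v', Move G v v' → Wins G c' v') : Wins G c v := by
  have h' : ∀ v' : V, ∃ N, Move G v v' → WinIn G N c' v' := fun v' => by
    by_cases hv : Move G v v'
    · obtain ⟨N, hN⟩ := h v' hv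
      exact ⟨N, fun _ => hN⟩
    · exact ⟨0, fun h => absurd h hv⟩
  choose N hN using h'
  obtain ⟨B, hB⟩ := (Set.finite_range N).bddAbove
  exact ⟨B + 1, c', hc, Or.inr fun v' hv' => (hN v' hv').mono (hB ⟨v', rfl⟩)⟩

theorem WinIn.comp_equiv {κ : Type*} (e : κ ≃ ι) :
    ∀ {N : ℕ} {c : ι → V} {v : V}, WinIn G N c v → WinIn G N (c ∘ e) v
  | 0, _, _, ⟨i, hi⟩ => ⟨e.symm i, by simpa using hi⟩
  | _ + 1, _, _, ⟨c', hc', h⟩ => ⟨c' ∘ e, fun i => hc' (e i),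
      h.imp (fun ⟨i, hi⟩ => ⟨e.symm i, by simpa using hi⟩)
        fun h v' hv' => (h v' hv').comp_equiv e⟩

theorem Wins.comp_equiv {κ : Type*} (e : κ ≃ ι) {c : ι → V} {v : V} (h : Wins G c v) :
    Wins G (c ∘ e) v :=
  h.imp fun _ hN => hN.comp_equiv e

/-- A move that is optimal for the least possible `N` serves every `N` at once. This makes a
strategy that depends only on the position possible. -/
theorem Wins.exists_move {c : ι → V} {v : V} (h : Wins G c v) :
    ∃ c' : ι → V, (∀ i, Move G (c i) (c' i)) ∧ ∀ N, WinIn G N c v →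
      (∃ i, c i = v) ∨ (∃ i, c' i = v) ∨
        ∃ N' < N, ∀ v', Move G v v' → WinIn G N' c' v' := by
  classical
  have hspec := Nat.find_spec h
  have hmin : ∀ N, WinIn G N c v → Nat.find h ≤ N := fun N hN => Nat.find_min' h hN
  generalize Nat.find h = m at hspec hmin
  cases m with
  | zero => exact ⟨c, fun _ => Or.inl rfl, fun _ _ => Or.inl hspec⟩
  | succ m =>
    obtain ⟨c', hc', h'⟩ := hspec
    exact ⟨c', hc', fun N hN => Or.inr (h'.imp_right fun h' => ⟨m, hmin N hN, h'⟩)⟩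

/-- Initial positions from which the cops win against every start of the robber yield a winning
strategy. -/
theorem copsWin_of_wins {k : ℕ} (c : Fin k → V) (h : ∀ v, Wins G c v) : CopsWin G k := by
  classical
  -- In a lost position the cops stay; such positions do not arise in the play below.
  let next : (Fin k → V) → V → Fin k → V := fun c v =>
    if h : Wins G c v then h.exists_move.choose else c
  have hnext : ∀ c v i, Move G (c i) (next c v i) := by
    intro c v i
    by_cases h : Wins G c v
    · simpa only [next, dif_pos h] using h.exists_move.choose_spec.1 i
    · simp only [next, dif_neg h]; exact Or.inl rfl
  let σ : List V → Fin k → V := fun l => l.rec c fun x _ p => next p x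
  refine ⟨σ, fun l x i => hnext (σ l) x i, fun ρ hρ => ?_⟩
  have key : ∀ N t, WinIn G N (σ (history ρ t)) (ρ t) →
      ∃ (t : ℕ) (i : Fin k), σ (history ρ t) i = ρ t ∨ σ (history ρ (t + 1)) i = ρ t := by
    intro N
    induction N using Nat.strong_induction_on with
    | _ N ih =>
      intro t ht
      have hw : Wins G (σ (history ρ t)) (ρ t) := ⟨N, ht⟩
      have hσ : σ (history ρ (t + 1)) = hw.exists_move.choose := by
        change next (σ (history ρ t)) (ρ t) = _
        simp only [next, dif_pos hw]
      rcases hw.exists_move.choose_spec.2 N ht with ⟨i, hi⟩ | ⟨i, hi⟩ | ⟨N', hN', h'⟩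
      · exact ⟨t, i, Or.inl hi⟩
      · exact ⟨t, i, Or.inr (by rw [hσ]; exact hi)⟩
      · exact ih N' hN' (t + 1) (by rw [hσ]; exact h' _ (hρ t))
  obtain ⟨N, hN⟩ := h (ρ 0)
  exact key N 0 hN

theorem copNumber_le_of_wins [Finite ι] (c : ι → V) (h : ∀ v, Wins G c v) :
    copNumber G ≤ Nat.card ι :=
  Nat.sInf_le (copsWin_of_wins (c ∘ (Finite.equivFin ι).symm) fun v => (h v).comp_equiv _)

theorem exists_move_edist_le {x z : V} {m : ℕ} (h : G.edist x z ≤ (m + 1 : ℕ)) :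
    ∃ x', Move G x x' ∧ G.edist x' z ≤ m := by
  obtain ⟨p, hp⟩ := SimpleGraph.exists_walk_of_edist_ne_top
    (ne_top_of_le_ne_top (ENat.natCast_ne_top _) h)
  rw [← hp] at h
  cases p with
  | nil => exact ⟨x, Or.inl rfl, by simp⟩
  | cons hadj p =>
    refine ⟨_, Or.inr hadj, p.edist_le.trans ?_⟩
    rw [SimpleGraph.Walk.length_cons] at h
    exact_mod_cast Nat.le_of_succ_le_succ (by exact_mod_cast h)

theorem Move.edist_le {x z : V} (h : Move G x z) : G.edist x z ≤ 1 := by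
  rcases h with rfl | h
  · simp
  · exact (SimpleGraph.edist_eq_one_iff_adj.2 h).le

theorem edist_le_add_one_of_move {v x z : V} (h : Move G x z) :
    G.edist v z ≤ G.edist v x + 1 :=
  SimpleGraph.edist_triangle.trans (by gcongr; exact h.edist_le)

/-- All cops walk to their targets `τ`. If the targets fill the inside of the ball of radius `r`
about the robber's vertex `v`, then the robber has to leave to the sphere of radius `r`, which
takes at least `r` moves. -/
theorem wins_of_targets [Finite V] [Finite ι] {c τ : ι → V} {v : V} {r : ℕ} (hr : 1 ≤ r)
    (ℓ : ι → ℕ) (hℓ : ∀ i, G.edist (c i) (τ i) ≤ ℓ i)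
    (hball : ∀ u, G.edist v u < r → u ∈ Set.range τ)
    (hout : ∀ (b : V) (c' : ι → V), G.edist v b = r →
      (∀ i, G.edist (c' i) (τ i) ≤ (ℓ i - r : ℕ)) → Wins G c' b) : Wins G c v := by
  -- Here `s` counts the moves made and `k` bounds those still needed for all cops to arrive. A
  -- robber still inside when `k = 0` stands on an occupied target.
  have key : ∀ (k s : ℕ) (c' : ι → V) (u : V), (∀ i, ℓ i ≤ s + k) → G.edist v u ≤ s →
      G.edist v u < r → (∀ i, G.edist (c' i) (τ i) ≤ (ℓ i - s : ℕ)) → Wins G c' u := by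
    intro k
    induction k with
    | zero =>
      intro s c' u hk _ hur hc'
      obtain ⟨i, rfl⟩ := hball u hur
      refine Wins.caught i ?_
      have := hc' i
      rw [Nat.sub_eq_zero_of_le (by simpa using hk i)] at this
      simpa using this
    | succ k ih =>
      intro s c' u hk hus hur hc'
      have hmv : ∀ i, ∃ x', Move G (c' i) x' ∧ G.edist x' (τ i) ≤ (ℓ i - (s + 1) : ℕ) := by
        intro i
        refine exists_move_edist_le ((hc' i).trans ?_)
        exact_mod_cast (by omega : ℓ i - s ≤ ℓ i - (s + 1) + 1)
      choose c'' h1 h2 using hmv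
      refine Wins.step h1 fun u' hu' => ?_
      have hd := edist_le_add_one_of_move (v := v) hu'
      have hd1 : G.edist v u' ≤ (s + 1 : ℕ) := hd.trans (by push_cast; gcongr)
      by_cases hlt : G.edist v u' < r
      · exact ih (s + 1) c'' u' (fun i => by have := hk i; omega) hd1 hlt h2
      · have hle : G.edist v u' ≤ r := hd.trans (Order.add_one_le_of_lt hur)
        have hrs : r ≤ s + 1 := by exact_mod_cast (not_lt.1 hlt).trans hd1
        refine hout u' c'' (le_antisymm hle (not_lt.1 hlt)) fun i => (h2 i).trans ?_
        exact_mod_cast (by omega : ℓ i - (s + 1) ≤ ℓ i - r)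
  obtain ⟨D, hD⟩ := (Set.finite_range ℓ).bddAbove
  exact key D 0 c v (fun i => by have := hD ⟨i, rfl⟩; omega) (by simp)
    (by simpa using Nat.pos_of_ne_zero (by omega)) (by simpa using hℓ)

theorem mem_sphere_singleton {v u : V} {r : ℕ} : u ∈ sphere G {v} r ↔ G.edist v u = r := by
  simp [sphere, setDist]

theorem mem_ball_singleton {v u : V} {r : ℕ} : u ∈ ball G {v} r ↔ G.edist v u ≤ r := by
  simp [ball, setDist]

/-- The guards on `X` stay, the cops of the team `o` occupy the inside of the ball of radius `r`
about the robber's vertex `v`, and the other cops go to their targets `τ`. -/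
theorem wins_of_occupy [Finite V] {S O : Type*} [Finite S] [Finite O] {X : Set V} {o : O → V}
    {c τ : S → V} {v : V} {r : ℕ} (hr : 1 ≤ r)
    (hO : {u | G.edist v u < r}.ncard ≤ Nat.card O) (ho : ∀ k, G.Reachable (o k) v)
    (ℓ : S → ℕ) (hℓ : ∀ i, G.edist (c i) (τ i) ≤ ℓ i)
    (hout : ∀ (b : V) (o' : O → V) (c' : S → V), G.edist v b = r → b ∉ X →
      (∀ k, G.Reachable (o' k) b) → (∀ i, G.edist (c' i) (τ i) ≤ (ℓ i - r : ℕ)) →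
      Wins G (Sum.elim (Sum.elim ((↑) : X → V) o') c') b) :
    Wins G (Sum.elim (Sum.elim ((↑) : X → V) o) c) v := by
  classical
  set B : Set V := {u | G.edist v u < r} with hB
  have hvB : v ∈ B := by simpa [hB] using Nat.pos_of_ne_zero (by omega)
  obtain ⟨g, hg⟩ : ∃ g : O → B, Function.Surjective g := by
    have : Nonempty B := ⟨⟨v, hvB⟩⟩
    have hle : Nat.card B ≤ Nat.card O := by rwa [Nat.card_coe_set_eq]
    have := Fintype.ofFinite B
    have := Fintype.ofFinite O
    rw [Nat.card_eq_fintype_card, Nat.card_eq_fintype_card] at hle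
    obtain ⟨f⟩ := Function.Embedding.nonempty_of_card_le hle
    exact ⟨Function.invFun f, Function.invFun_surjective f.injective⟩
  have hgr : ∀ k, G.Reachable v (g k) := fun k =>
    SimpleGraph.reachable_of_edist_ne_top (ne_top_of_lt (g k).2)
  -- The walking time of the team `o` is irrelevant: a robber who waits inside the ball only gives
  -- the others more time. Being in his component is all that the team needs, also for the next
  -- round.
  have hfin : ∀ k, ∃ m : ℕ, G.edist (o k) (g k) ≤ m := fun k => by
    have h : G.edist (o k) (g k) ≠ ⊤ :=
      SimpleGraph.edist_ne_top_iff_reachable.2 ((ho k).trans (hgr k))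
    obtain ⟨m, hm⟩ := ENat.ne_top_iff_exists.1 h
    exact ⟨m, hm.ge⟩
  choose m hm using hfin
  refine wins_of_targets hr (τ := Sum.elim (Sum.elim (↑) fun k => (g k : V)) τ)
    (Sum.elim (Sum.elim 0 m) ℓ) ?_ ?_ ?_
  · rintro ((x | k) | i)
    · simp
    · exact hm k
    · exact hℓ i
  · intro u hu
    obtain ⟨k, hk⟩ := hg ⟨u, hu⟩
    exact ⟨Sum.inl (Sum.inr k), by simp [hk]⟩
  · intro b c' hb hc'
    have hcX : ∀ x : X, c' (Sum.inl (Sum.inl x)) = x := fun x => by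
      simpa using hc' (Sum.inl (Sum.inl x))
    by_cases hbX : b ∈ X
    · exact Wins.caught _ (hcX ⟨b, hbX⟩)
    · have hvb : G.Reachable v b :=
        SimpleGraph.reachable_of_edist_ne_top (by rw [hb]; exact ENat.natCast_ne_top _)
      have := hout b (fun k => c' (Sum.inl (Sum.inr k))) (fun i => c' (Sum.inr i)) hb hbX
        (fun k => ((SimpleGraph.reachable_of_edist_ne_top
          (ne_top_of_le_ne_top (ENat.natCast_ne_top _) (hc' (Sum.inl (Sum.inr k))))).trans
            (hgr k).symm).trans hvb)
        (fun i => hc' (Sum.inr i))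
      convert this using 1
      ext ((x | k) | i)
      · exact hcX x
      · rfl
      · rfl

end Game

/-! ### Random teams of cops, by counting functions. -/

section Random

theorem sum_pow_card_le (α : Type*) [Fintype α] {x : ℝ} (hx : 0 ≤ x)
    (h : x * (4 * Fintype.card α) ≤ 1) : ∑ S : Finset α, x ^ S.card ≤ Real.exp (1 / 4) := by
  have := Fintype.sum_pow_mul_eq_add_pow α x 1
  simp only [one_pow, mul_one] at this
  rw [this]
  calc (x + 1) ^ Fintype.card α ≤ (Real.exp x) ^ Fintype.card α := by
        gcongr; exact Real.add_one_le_exp x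
    _ = Real.exp (Fintype.card α * x) := by rw [Real.exp_nat_mul]
    _ ≤ Real.exp (1 / 4) := by
      apply Real.exp_le_exp.2
      linarith

/-- This bounds the failure probability in `exists_function_hall`; the -1 comes from omitting the
empty set. -/
theorem exp_quarter_sub_one_mul_lt : (Real.exp (1 / 4) - 1) * Real.exp (1 / 4) < 1 := by
  have h4 : Real.exp (1 / 4) ^ 4 = Real.exp 1 := by
    rw [← Real.exp_nat_mul]; norm_num
  have h3 := Real.exp_one_lt_d9
  have h5 : 0 < Real.exp (1 / 4) := Real.exp_pos _
  have h6 : Real.exp (1 / 4) < 1.3 := by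
    by_contra! h
    have : (1.3 : ℝ) ^ 4 ≤ Real.exp (1 / 4) ^ 4 := by gcongr
    rw [h4] at this
    norm_num at this h3 ⊢
    linarith
  nlinarith

variable {V : Type*} [Fintype V] [DecidableEq V]

/-- A union bound for a uniformly random function `f : Fin m → V` and the events that `f` maps no
element of `J b` into `N b`. -/
theorem exists_function_hitting [Nonempty V] {m : ℕ} {β : Type*} (I : Finset β)
    (J : β → Finset (Fin m)) (N : β → Finset V)
    (h : ∑ b ∈ I, Real.exp (-((J b).card * (N b).card / Fintype.card V)) < 1) :
    ∃ f : Fin m → V, ∀ b ∈ I, ∃ j ∈ J b, f j ∈ N b := by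
  classical
  by_contra! hcon
  set n := Fintype.card V with hn
  have hn0 : (0 : ℝ) < n := by exact_mod_cast Fintype.card_pos
  -- The bad functions for `b`; they make up a fraction (1 - |N b|/n)^{|J b|} of all functions.
  let E : β → Finset (Fin m → V) := fun b =>
    Fintype.piFinset fun j => if j ∈ J b then (N b)ᶜ else Finset.univ
  have hcover : (Finset.univ : Finset (Fin m → V)) ⊆ I.biUnion E := by
    intro f _
    obtain ⟨b, hb, hf⟩ := hcon f
    refine Finset.mem_biUnion.2 ⟨b, hb, Fintype.mem_piFinset.2 fun j => ?_⟩
    by_cases hj : j ∈ J b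
    · simpa [hj] using hf j hj
    · simp [hj]
  have hE : ∀ b, ((E b).card : ℝ) ≤
      (n : ℝ) ^ m * Real.exp (-((J b).card * (N b).card / n)) := by
    intro b
    have hle : (N b).card ≤ n := Finset.card_le_univ _
    have h1 : ∀ j : Fin m, (((if j ∈ J b then (N b)ᶜ else Finset.univ : Finset V).card : ℕ) : ℝ)
        ≤ n * (if j ∈ J b then Real.exp (-((N b).card / n)) else 1) := by
      intro j
      by_cases hj : j ∈ J b
      · simp only [hj, if_true, Finset.card_compl, ← hn]
        rw [Nat.cast_sub hle]
        have := Real.add_one_le_exp (-((N b).card / n : ℝ))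
        calc (n : ℝ) - (N b).card = n * (-((N b).card / n) + 1) := by field_simp; ring
          _ ≤ _ := by gcongr
      · simp [hj, hn]
    calc ((E b).card : ℝ) = ∏ j : Fin m,
          (((if j ∈ J b then (N b)ᶜ else Finset.univ : Finset V).card : ℕ) : ℝ) := by
          simp only [E, Fintype.card_piFinset]; push_cast; rfl
      _ ≤ ∏ j : Fin m, (n * (if j ∈ J b then Real.exp (-((N b).card / n)) else 1) : ℝ) :=
          Finset.prod_le_prod (fun _ _ => Nat.cast_nonneg _) fun j _ => h1 j
      _ = _ := by
          rw [Finset.prod_mul_distrib, Finset.prod_ite_mem, Finset.prod_const, Finset.prod_const,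
            Finset.univ_inter, Finset.card_univ, Fintype.card_fin, ← Real.exp_nat_mul]
          congr 2
          ring
  have hcard : ((n : ℝ) ^ m) ≤ ∑ b ∈ I, (n : ℝ) ^ m *
      Real.exp (-((J b).card * (N b).card / n)) := by
    have h2 : Fintype.card (Fin m → V) ≤ ∑ b ∈ I, (E b).card :=
      (Finset.card_le_card hcover).trans Finset.card_biUnion_le
    rw [Fintype.card_fun, Fintype.card_fin, ← hn] at h2
    calc ((n : ℝ) ^ m) ≤ ∑ b ∈ I, ((E b).card : ℝ) := by exact_mod_cast h2
      _ ≤ _ := Finset.sum_le_sum fun b _ => hE b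
  rw [← Finset.mul_sum] at hcard
  have : (0 : ℝ) < (n : ℝ) ^ m := by positivity
  nlinarith

/-- A function `f` such that in each of the sets `T b` few of the pairwise disjoint large sets
`W b w` are missed by `f`. -/
theorem exists_function_few_missed [Nonempty V] {m N k : ℕ} {ω : ℝ} {β : Type*} (I : Finset β)
    (T : β → Finset V) (W : β → V → Finset V)
    (hdisj : ∀ b ∈ I, (T b : Set V).PairwiseDisjoint (W b))
    (hW : ∀ b ∈ I, ∀ w ∈ T b, ω ≤ (W b w).card) (hT : ∀ b ∈ I, (T b).card ≤ N)
    (h : I.card * (N.choose k * Real.exp (-(m * (k * ω) / Fintype.card V))) < 1) :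
    ∃ f : Fin m → V, ∀ b ∈ I, {w ∈ T b | ∀ j, f j ∉ W b w}.card < k := by
  classical
  -- One event for each `k`-subset `B` of `T b`: all its sets are missed. Disjointness gives their
  -- union at least `k * ω` elements.
  obtain ⟨f, hf⟩ := exists_function_hitting (m := m)
    (I.sigma fun b => (T b).powersetCard k) (fun _ => Finset.univ)
    (fun x => x.2.biUnion (W x.1)) (by
      refine lt_of_le_of_lt ?_ h
      rw [Finset.sum_sigma, ← nsmul_eq_mul]
      refine Finset.sum_le_card_nsmul _ _ _ fun b hb => ?_
      have h1 : ∀ B ∈ (T b).powersetCard k,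
          Real.exp (-((Finset.univ : Finset (Fin m)).card * (B.biUnion (W b)).card /
            Fintype.card V)) ≤ Real.exp (-(m * (k * ω) / Fintype.card V)) := by
        intro B hB
        rw [Finset.mem_powersetCard] at hB
        rw [Finset.card_univ, Fintype.card_fin]
        gcongr
        rw [Finset.card_biUnion fun x hx y hy hxy => hdisj b hb (hB.1 hx) (hB.1 hy) hxy]
        push_cast
        rw [← hB.2, ← nsmul_eq_mul]
        exact Finset.card_nsmul_le_sum _ _ _ fun w hw => hW b hb w (hB.1 hw)
      refine (Finset.sum_le_card_nsmul _ _ _ h1).trans ?_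
      rw [nsmul_eq_mul, Finset.card_powersetCard]
      gcongr
      exact hT b hb)
  refine ⟨f, fun b hb => ?_⟩
  by_contra! hcon
  obtain ⟨B, hB, hBk⟩ := Finset.exists_subset_card_eq hcon
  obtain ⟨j, _, hj⟩ := hf ⟨b, B⟩ (Finset.mem_sigma.2 ⟨hb, Finset.mem_powersetCard.2
    ⟨hB.trans (Finset.filter_subset _ _), hBk⟩⟩)
  obtain ⟨w, hw, hjw⟩ := Finset.mem_biUnion.1 hj
  exact (Finset.mem_filter.1 (hB hw)).2 j hjw

/-- A function `g` which satisfies Hall's condition for all small sets `S` with a large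
neighbourhood `N S`. -/
theorem exists_function_hall [Nonempty V] {m : ℕ} {κ : ℝ} (hm : m ≤ Fintype.card V)
    (hκ : Real.exp (-κ) * (4 * Fintype.card V) ≤ 1) (N : Finset V → Finset V) :
    ∃ g : Fin m → V, ∀ S : Finset V, 2 * S.card ≤ m →
      4 * κ * Fintype.card V * S.card ≤ m * (N S).card →
      S.card ≤ {j | g j ∈ N S}.ncard := by
  classical
  set n := Fintype.card V with hn
  have hn1 : (1 : ℝ) ≤ n := by exact_mod_cast Fintype.card_pos
  set x := Real.exp (-κ) with hx
  have hx0 : 0 < x := Real.exp_pos _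
  have hx1 : x ≤ 1 := by nlinarith
  have hκ0 : 0 ≤ κ := by
    have : -κ ≤ 0 := Real.exp_le_one_iff.1 hx1
    linarith
  -- If Hall's condition fails for `S`, the set `I` of cops in `N S` is smaller than `S`, and the at
  -- least `m / 2` cops outside `I` all miss `N S`. This has probability at most exp(-2κ|S|) ≤
  -- exp(-κ|S|) exp(-κ|I|), and the sum over all pairs factorizes.
  let C : Finset V × Finset (Fin m) → Prop := fun p =>
    p.1.Nonempty ∧ p.2.card ≤ p.1.card ∧ 2 * p.1.card ≤ m ∧
      4 * κ * n * p.1.card ≤ m * (N p.1).card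
  obtain ⟨g, hg⟩ := exists_function_hitting (m := m)
    ({p : Finset V × Finset (Fin m) | C p} : Finset _) (fun p => p.2ᶜ) (fun p => N p.1) (by
      have hterm : ∀ p : Finset V × Finset (Fin m), C p →
          Real.exp (-((p.2ᶜ.card : ℝ) * (N p.1).card / n)) ≤ x ^ p.1.card * x ^ p.2.card := by
        rintro ⟨S, I⟩ ⟨_, h1, h2, h3⟩
        dsimp only at *
        rw [hx, ← Real.exp_nat_mul, ← Real.exp_nat_mul, ← Real.exp_add]
        apply Real.exp_le_exp.2
        have hI : (m : ℝ) / 2 ≤ (Iᶜ.card : ℝ) := by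
          rw [Finset.card_compl, Fintype.card_fin, Nat.cast_sub (by omega)]
          have : (2 * I.card : ℝ) ≤ m := by exact_mod_cast (by omega : 2 * I.card ≤ m)
          linarith
        have hIS : (I.card : ℝ) ≤ S.card := by exact_mod_cast h1
        have h4 : 2 * κ * S.card ≤ (Iᶜ.card : ℝ) * (N S).card / n := by
          rw [le_div_iff₀ (by linarith)]
          calc 2 * κ * S.card * n = (4 * κ * n * S.card) / 2 := by ring
            _ ≤ (m * (N S).card) / 2 := by gcongr
            _ = m / 2 * (N S).card := by ring
            _ ≤ _ := by gcongr
        nlinarith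
      calc ∑ p ∈ ({p : Finset V × Finset (Fin m) | C p} : Finset _),
            Real.exp (-((p.2ᶜ.card : ℝ) * (N p.1).card / n))
          ≤ ∑ p ∈ ({p : Finset V × Finset (Fin m) | C p} : Finset _),
            x ^ p.1.card * x ^ p.2.card :=
            Finset.sum_le_sum fun p hp => hterm p (by simpa using hp)
        _ ≤ ∑ p ∈ ((Finset.univ.erase (∅ : Finset V)) ×ˢ (Finset.univ : Finset (Finset (Fin m)))),
            x ^ p.1.card * x ^ p.2.card := by
            refine Finset.sum_le_sum_of_subset_of_nonneg ?_ fun _ _ _ => by positivity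
            intro p hp
            have : C p := by simpa using hp
            simpa using this.1.ne_empty
        _ = (∑ S ∈ Finset.univ.erase (∅ : Finset V), x ^ S.card) *
            ∑ I : Finset (Fin m), x ^ I.card := by
            rw [Finset.sum_mul_sum, Finset.sum_product]
        _ ≤ (Real.exp (1 / 4) - 1) * Real.exp (1 / 4) := by
            have h1 := sum_pow_card_le V hx0.le (by linarith)
            rw [← Finset.add_sum_erase _ _ (Finset.mem_univ (∅ : Finset V))] at h1
            simp only [Finset.card_empty, pow_zero] at h1
            have hmn : (m : ℝ) ≤ n := by exact_mod_cast hm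
            have h2 := sum_pow_card_le (Fin m) hx0.le (by
              rw [Fintype.card_fin]; nlinarith)
            have : 1 ≤ Real.exp (1 / 4) := Real.one_le_exp (by norm_num)
            gcongr
            · linarith
        _ < 1 := exp_quarter_sub_one_mul_lt)
  refine ⟨g, fun S hS hN => ?_⟩
  by_contra! hcon
  set I : Finset (Fin m) := {j | g j ∈ N S} with hI
  have hIcard : {j | g j ∈ N S}.ncard = I.card := by
    rw [← Set.ncard_coe_finset]; congr 1; ext; simp [hI]
  rw [hIcard] at hcon
  obtain ⟨j, hj, hjN⟩ := hg (S, I) (by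
    simp only [Finset.mem_filter, Finset.mem_univ, true_and]
    exact ⟨Finset.card_pos.1 (Nat.zero_lt_of_lt hcon), hcon.le, hS, hN⟩)
  simp [hI] at hj
  exact hj hjN

end Random

/-! ### Assigning targets to cops. -/

section Targets

variable {V : Type*} {G : SimpleGraph V}

/-- Hall's theorem for cops on `g` and the vertices of `U` as their targets. -/
theorem exists_targets_of_hall [Finite V] {ι : Type*} [Finite ι] {g : ι → V} {U : Set V} {t : ℕ}
    (h : ∀ S : Finset V, ↑S ⊆ U → S.card ≤ {j | g j ∈ ball G (S : Set V) t}.ncard) :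
    ∃ τ : ι → V, (∀ j, G.edist (g j) (τ j) ≤ t) ∧ U ⊆ Set.range τ := by
  classical
  have := Fintype.ofFinite ι
  let N : U → Finset ι := fun w => {j | G.edist w (g j) ≤ t}
  obtain ⟨φ, hφ, hφN⟩ := (Finset.all_card_le_biUnion_card_iff_exists_injective N).1 (by
    intro s
    have h1 := h (s.map (Function.Embedding.subtype _)) (by
      intro w hw
      simp only [Finset.coe_map, Function.Embedding.subtype_apply, Set.mem_image] at hw
      obtain ⟨x, _, rfl⟩ := hw
      exact x.2)
    rw [Finset.card_map] at h1
    refine h1.trans ?_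
    rw [← Set.ncard_coe_finset (s.biUnion N)]
    refine Set.ncard_le_ncard (fun j hj => ?_) (Set.toFinite _)
    simp only [ball, setDist, Set.mem_ofPred_eq] at hj
    have : ∃ w ∈ s, G.edist (w : V) (g j) ≤ t := by
      by_contra! hcon
      have h2 : ((t + 1 : ℕ) : ℕ∞) ≤
          ⨅ v ∈ ((s.map (Function.Embedding.subtype _) : Finset V) : Set V), G.edist v (g j) := by
        refine le_iInf₂ fun v hv => ?_
        simp only [Finset.coe_map, Function.Embedding.subtype_apply, Set.mem_image] at hv
        obtain ⟨x, hx, rfl⟩ := hv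
        have := Order.add_one_le_of_lt (hcon x hx)
        exact_mod_cast this
      have h3 : t + 1 ≤ t := by exact_mod_cast h2.trans hj
      omega
    obtain ⟨w, hw, hwj⟩ := this
    simp only [Finset.coe_biUnion, Set.mem_iUnion]
    exact ⟨w, hw, by simpa [N] using hwj⟩)
  refine ⟨fun j => if hj : ∃ w, φ w = j then (hj.choose : V) else g j, fun j => ?_,
    fun w hw => ⟨φ ⟨w, hw⟩, ?_⟩⟩
  · dsimp only
    split_ifs with hj
    · have h1 := hφN hj.choose
      rw [hj.choose_spec] at h1
      rw [SimpleGraph.edist_comm]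
      simpa [N] using h1
    · simp
  · have hj : ∃ w', φ w' = φ ⟨w, hw⟩ := ⟨_, rfl⟩
    dsimp only
    rw [dif_pos hj, hφ hj.choose_spec]

/-- Cops on `f` go to the vertices `w` for which the set `W w` has one of them. -/
theorem exists_targets_of_disjoint {ι : Type*} {f : ι → V} {U : Set V} {W : V → Set V} {t : ℕ}
    (hdisj : U.PairwiseDisjoint W) (hW : ∀ w ∈ U, W w ⊆ ball G {w} t) :
    ∃ τ : ι → V, (∀ j, G.edist (f j) (τ j) ≤ t) ∧
      ∀ w ∈ U, (∃ j, f j ∈ W w) → w ∈ Set.range τ := by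
  classical
  refine ⟨fun j => if hj : ∃ w ∈ U, f j ∈ W w then hj.choose else f j, fun j => ?_,
    fun w hw ⟨j, hjw⟩ => ⟨j, ?_⟩⟩
  · dsimp only
    split_ifs with hj
    · rw [SimpleGraph.edist_comm]
      exact mem_ball_singleton.1 (hW _ hj.choose_spec.1 hj.choose_spec.2)
    · simp
  · have hj : ∃ w ∈ U, f j ∈ W w := ⟨w, hw, hjw⟩
    dsimp only
    rw [dif_pos hj]
    exact hdisj.elim_set hj.choose_spec.1 hw _ hj.choose_spec.2 hjw

end Targets

/-! ### Sizes of spheres and balls, and the team for small sets. -/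

section Expansion

variable {V : Type*} {G : SimpleGraph V} {X : Set V} {d q y a₁ a₂ a₃ a₄ a₅ : ℝ}

/-- The expansion properties of the graph `G` with `q ^ 4` vertices outside of a set `X`, for an
error parameter `y` which dominates the degree `d`, the constants and the logarithm of the order,
while its powers are small compared with `q`. -/
structure Expands (G : SimpleGraph V) (X : Set V) (d q y a₁ a₂ a₃ a₄ a₅ : ℝ) : Prop where
  card_eq : (Nat.card V : ℝ) = q ^ 4
  two_le : 2 ≤ d
  d_le : d ≤ y
  pow_le : y ^ 20 ≤ q
  a₁_pos : 0 < a₁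
  a₂_pos : 0 < a₂
  a₃_pos : 0 < a₃
  a₄_pos : 0 < a₄
  a₅_pos : 0 < a₅
  a₂_le : 8 * a₂ ≤ y
  le_a₂ : 8 ≤ y * a₂
  ratio_le : √a₃ / a₂ ≤ y
  le_ratio : 1 ≤ y * (√a₃ / a₂)
  log_le : Real.log (q ^ 4) ≤ y
  exp_le : Real.exp (-(a₁ * y / 4)) * (4 * q ^ 4) ≤ 1
  growth : ∀ v ∉ X, ∀ r r' : ℕ, 1 ≤ r → d ^ r ≤ q ^ 2 * y ^ 3 → 1 ≤ r' → d ^ r' ≤ q ^ 2 * y ^ 3 →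
    ∀ V' ⊆ ball G {v} r \ X, (V'.ncard : ℝ) * d ^ r' * y ≤ q ^ 4 →
      a₁ * V'.ncard * d ^ r' ≤ (sphere G V' r').ncard ∧
        (sphere G V' r').ncard ≤ a₂ * V'.ncard * d ^ r'
  accessible : ∀ r r' : ℕ, q ≤ y ^ 2 * d ^ r → d ^ r ≤ q * y ^ 6 → q ≤ y ^ 2 * d ^ r' →
    d ^ r' ≤ q * y ^ 6 → ∀ v ∉ X, ∀ A ⊆ sphere G {v} r \ X, q ≤ y ^ 8 * A.ncard →
    d ^ (r + r') < a₃ * q ^ 4 / (⋃ a ∈ A, sphere G {a} r').ncard →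
    ∃ Q : Set V, (∀ a ∈ A, y ^ 10 * (sphere G {a} r' ∩ Q).ncard ≤ q) ∧
      Accessible G d (r + r' + 1) a₄ a₅ ((⋃ a ∈ A, sphere G {a} r') \ Q)

namespace Expands

theorem two_le_y (H : Expands G X d q y a₁ a₂ a₃ a₄ a₅) : 2 ≤ y := H.two_le.trans H.d_le

theorem pow_le_q (H : Expands G X d q y a₁ a₂ a₃ a₄ a₅) {k : ℕ} (hk : k ≤ 20) : y ^ k ≤ q :=
  (pow_le_pow_right₀ (by linarith [H.two_le_y]) hk).trans H.pow_le

theorem y_le_q (H : Expands G X d q y a₁ a₂ a₃ a₄ a₅) : y ≤ q := by simpa using H.pow_le_q (k := 1) (by norm_num)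

theorem two_le_q (H : Expands G X d q y a₁ a₂ a₃ a₄ a₅) : 2 ≤ q := H.two_le_y.trans H.y_le_q

theorem d_pos (H : Expands G X d q y a₁ a₂ a₃ a₄ a₅) : 0 < d := by linarith [H.two_le]

theorem finite (H : Expands G X d q y a₁ a₂ a₃ a₄ a₅) : Finite V := by
  refine Nat.finite_of_card_ne_zero fun h => ?_
  have := H.card_eq
  rw [h] at this
  have : 0 < q ^ 4 := by have := H.two_le_q; positivity
  simp_all

theorem sphere_bounds (H : Expands G X d q y a₁ a₂ a₃ a₄ a₅) {v : V} (hv : v ∉ X) {r : ℕ} (hr : 1 ≤ r) (hd : d ^ r * y ≤ q ^ 2) :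
    a₁ * d ^ r ≤ (sphere G {v} r).ncard ∧ (sphere G {v} r).ncard ≤ a₂ * d ^ r := by
  have hy := H.two_le_y
  have hq := H.two_le_q
  have hy3 : 1 ≤ y ^ 3 := one_le_pow₀ (by linarith)
  have hdr : 0 < d ^ r := pow_pos H.d_pos r
  have h1 : d ≤ q ^ 2 * y ^ 3 := by
    have h2 := H.d_le
    have h3 := H.y_le_q
    nlinarith
  have h2 : d ^ r ≤ q ^ 2 * y ^ 3 := by nlinarith [sq_nonneg q]
  have h3 : q ^ 2 ≤ q ^ 4 := pow_le_pow_right₀ (by linarith) (by norm_num)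
  have := H.growth v hv 1 r le_rfl (by simpa using h1) hr h2 {v}
    (by simpa [mem_ball_singleton] using hv) (by simp; linarith)
  simpa using this

/-- The spheres inside the ball grow geometrically: as d ≥ 2, the bound for radius r + 1 absorbs
twice that for radius r. -/
theorem ncard_edist_lt_le (H : Expands G X d q y a₁ a₂ a₃ a₄ a₅) {v : V} (hv : v ∉ X) {r : ℕ} (hd : d ^ r * y ≤ q ^ 2) :
    ({u | G.edist v u < r}.ncard : ℝ) ≤ 1 + a₂ * d ^ r := by
  have := H.finite
  have ha := H.a₂_pos
  have hdp := H.d_pos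
  have hd2 := H.two_le
  induction r with
  | zero => simp; linarith
  | succ r ih =>
    have hmono : d ^ r ≤ d ^ (r + 1) := pow_le_pow_right₀ (by linarith) (by omega)
    have hd' : d ^ r * y ≤ q ^ 2 :=
      (mul_le_mul_of_nonneg_right hmono (by linarith [H.two_le_y])).trans hd
    have ih := ih hd'
    have hpos : 0 < d ^ r := pow_pos hdp r
    rcases Nat.eq_zero_or_pos r with rfl | hr
    · have : {u | G.edist v u < ((0 + 1 : ℕ) : ℕ∞)} = {v} := by
        ext u
        refine ⟨fun h => by simpa using h, ?_⟩
        rintro rfl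
        simp
      rw [this, Set.ncard_singleton]
      push_cast
      have : 0 ≤ a₂ * d ^ (0 + 1) := by positivity
      simpa using this
    · have hsub : {u | G.edist v u < ((r + 1 : ℕ) : ℕ∞)} ⊆
          {u | G.edist v u < r} ∪ sphere G {v} r := by
        intro u hu
        have hu' : G.edist v u ≤ r := by
          have : G.edist v u < (r : ℕ∞) + 1 := by exact_mod_cast hu
          exact (ENat.lt_add_one_iff (ENat.natCast_ne_top r)).1 this
        rcases hu'.lt_or_eq with h | h
        · exact Or.inl h
        · exact Or.inr (mem_sphere_singleton.2 h)
      have h1 := (Set.ncard_le_ncard hsub (Set.toFinite _)).trans (Set.ncard_union_le _ _)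
      have h2 : ({u | G.edist v u < ((r + 1 : ℕ) : ℕ∞)}.ncard : ℝ) ≤
          {u | G.edist v u < r}.ncard + (sphere G {v} r).ncard := by exact_mod_cast h1
      have h3 := (H.sphere_bounds hv hr hd').2
      have h4 : 2 * d ^ r ≤ d ^ (r + 1) := by rw [pow_succ]; nlinarith
      nlinarith

/-- For all radii used in the rounds, a team of about √n cops can fill the inside of the ball. -/
theorem ncard_edist_lt_le_ceil (H : Expands G X d q y a₁ a₂ a₃ a₄ a₅) {v : V} (hv : v ∉ X) {r : ℕ} (hd : d ^ r ≤ q * y ^ 6) :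
    {u | G.edist v u < r}.ncard ≤ Nat.card (Fin ⌈q ^ 2⌉₊) := by
  have hy := H.two_le_y
  have hq := H.two_le_q
  have ha := H.a₂_le
  have ha' := H.a₂_pos
  have h8 := H.pow_le_q (k := 8) (by norm_num)
  have h7 := H.pow_le_q (k := 7) (by norm_num)
  have h1 : d ^ r * y ≤ q ^ 2 := by
    calc d ^ r * y ≤ q * y ^ 6 * y := by gcongr
      _ = q * y ^ 7 := by ring
      _ ≤ q * q := by gcongr
      _ = q ^ 2 := by ring
  have h2 := H.ncard_edist_lt_le hv h1
  rw [Nat.card_eq_fintype_card, Fintype.card_fin]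
  have h3 : 1 + a₂ * d ^ r ≤ q ^ 2 := by
    have : 0 < d ^ r := pow_pos H.d_pos r
    have h4 : a₂ * d ^ r ≤ q ^ 2 / 8 := by nlinarith
    nlinarith
  exact_mod_cast (h2.trans h3).trans (Nat.le_ceil _)

theorem ncard_iUnion_sphere_le (H : Expands G X d q y a₁ a₂ a₃ a₄ a₅) {A : Set V} (hA : ∀ a ∈ A, a ∉ X) {r : ℕ} (hr : 1 ≤ r)
    (hd : d ^ r * y ≤ q ^ 2) :
    ((⋃ a ∈ A, sphere G {a} r).ncard : ℝ) ≤ A.ncard * (a₂ * d ^ r) := by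
  classical
  have := H.finite
  have := Fintype.ofFinite V
  have h1 : (⋃ a ∈ A, sphere G {a} r) =
      ((A.toFinset.biUnion fun a => (sphere G {a} r).toFinset : Finset V) : Set V) := by
    ext; simp
  rw [h1, Set.ncard_coe_finset]
  calc (((A.toFinset.biUnion fun a => (sphere G {a} r).toFinset).card : ℕ) : ℝ)
      ≤ ∑ a ∈ A.toFinset, ((sphere G {a} r).toFinset.card : ℝ) := by
        exact_mod_cast Finset.card_biUnion_le
    _ ≤ A.toFinset.card • (a₂ * d ^ r) := by
        refine Finset.sum_le_card_nsmul _ _ _ fun a ha => ?_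
        rw [← Set.ncard_eq_toFinset_card']
        exact (H.sphere_bounds (hA a (by simpa using ha)) hr hd).2
    _ = _ := by rw [nsmul_eq_mul, Set.ncard_eq_toFinset_card']

theorem exists_final_radius (H : Expands G X d q y a₁ a₂ a₃ a₄ a₅) : ∃ t : ℕ, d ^ (t - 1) ≤ q ^ 2 * y ∧ q ^ 2 * y ≤ d ^ t ∧ 1 ≤ t := by
  obtain ⟨k, h1, h2⟩ := exists_nat_pow_near (x := q ^ 2 * y) (y := d)
    (by nlinarith [H.two_le_y, H.two_le_q, sq_nonneg q]) (by linarith [H.two_le])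
  exact ⟨k + 1, h1, h2.le, by omega⟩

/-- A team of cops that can cover every small set of vertices in time `t`. -/
theorem exists_hall_team (H : Expands G X d q y a₁ a₂ a₃ a₄ a₅) {t : ℕ} (ht : 1 ≤ t) (ht1 : d ^ (t - 1) ≤ q ^ 2 * y)
    (ht2 : q ^ 2 * y ≤ d ^ t) :
    ∃ g : Fin ⌈q ^ 2⌉₊ → V, ∀ v ∉ X, ∀ U ⊆ ball G {v} (t - 1) \ X, 2 ≤ t →
      y ^ 5 * U.ncard ≤ a₂ * d ^ (t - 1) →
      ∃ τ : Fin ⌈q ^ 2⌉₊ → V, (∀ j, G.edist (g j) (τ j) ≤ t) ∧ U ⊆ Set.range τ := by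
  classical
  have := H.finite
  have := Fintype.ofFinite V
  have hy := H.two_le_y
  have hq := H.two_le_q
  have ha := H.a₂_le
  have ha1 := H.a₁_pos
  have hn : (Fintype.card V : ℝ) = q ^ 4 := by rw [← H.card_eq, Nat.card_eq_fintype_card]
  have : Nonempty V := by
    rw [← Fintype.card_pos_iff, ← Nat.cast_pos (α := ℝ), hn]
    positivity
  have hm : ⌈q ^ 2⌉₊ ≤ Fintype.card V := by
    rw [Nat.ceil_le, hn]
    exact pow_le_pow_right₀ (by linarith) (by norm_num)
  -- The choice of `κ` matches the growth bound: |S(S, t)| ≥ a₁ |S| q² y, and q² cops meet a set of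
  -- this size about a₁ y |S| = 4κ|S| times in the mean.
  obtain ⟨g, hg⟩ := exists_function_hall (κ := a₁ * y / 4) hm (by rw [hn]; exact H.exp_le)
    fun S => (ball G (S : Set V) t).toFinset
  have hd1 : d ^ t ≤ q ^ 2 * y ^ 2 := by
    obtain ⟨k, rfl⟩ : ∃ k, t = k + 1 := ⟨t - 1, by omega⟩
    rw [pow_succ]
    calc d ^ k * d ≤ (q ^ 2 * y) * y := by
          gcongr
          · linarith [H.two_le]
          · simpa using ht1
          · exact H.d_le
      _ = _ := by ring
  refine ⟨g, fun v hv U hU ht hUcard => exists_targets_of_hall fun S hS => ?_⟩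
  have hSU : (S.card : ℝ) ≤ U.ncard := by
    rw [← Set.ncard_coe_finset]
    exact_mod_cast Set.ncard_le_ncard hS (Set.toFinite _)
  have hmq : q ^ 2 ≤ (⌈q ^ 2⌉₊ : ℝ) := Nat.le_ceil _
  have hS1 : y ^ 5 * S.card ≤ y / 8 * (q ^ 2 * y) := by
    calc y ^ 5 * (S.card : ℝ) ≤ y ^ 5 * U.ncard := by gcongr
      _ ≤ a₂ * d ^ (t - 1) := hUcard
      _ ≤ y / 8 * (q ^ 2 * y) := by
        have := pow_pos H.d_pos (t - 1)
        have := H.a₂_pos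
        gcongr
        linarith
  have hS2 : y ^ 3 * S.card ≤ q ^ 2 / 8 := by
    have : 0 < y ^ 2 := by positivity
    nlinarith
  have hy3 : 1 ≤ y ^ 3 := one_le_pow₀ (by linarith)
  have hgr := (H.growth v hv (t - 1) t (by omega) (ht1.trans (by
      gcongr; exact le_self_pow₀ (by linarith) (by norm_num))) (by omega) (hd1.trans (by
      gcongr <;> linarith)) S (hS.trans hU) (by
      rw [Set.ncard_coe_finset]
      calc (S.card : ℝ) * d ^ t * y ≤ S.card * (q ^ 2 * y ^ 2) * y := by gcongr
        _ = (y ^ 3 * S.card) * q ^ 2 := by ring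
        _ ≤ (q ^ 2 / 8) * q ^ 2 := by gcongr
        _ ≤ q ^ 4 := by nlinarith [sq_nonneg (q ^ 2)])).1
  rw [Set.ncard_coe_finset] at hgr
  have hball : ((sphere G (S : Set V) t).ncard : ℝ) ≤
      ((ball G (S : Set V) t).toFinset.card : ℝ) := by
    rw [← Set.ncard_eq_toFinset_card']
    exact_mod_cast Set.ncard_le_ncard (fun u hu => le_of_eq hu) (Set.toFinite _)
  have := hg S (by
    have : (2 * S.card : ℝ) ≤ ⌈q ^ 2⌉₊ := by nlinarith
    exact_mod_cast this) (by
    rw [hn]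
    calc 4 * (a₁ * y / 4) * q ^ 4 * S.card = q ^ 2 * (a₁ * S.card * (q ^ 2 * y)) := by ring
      _ ≤ ⌈q ^ 2⌉₊ * (a₁ * S.card * d ^ t) := by gcongr
      _ ≤ _ := by gcongr; exact hgr.trans hball)
  simpa using this

end Expands

/-! ### The rounds of the game. -/

theorem move_of_edist_le_one {x z : V} (h : G.edist x z ≤ 1) : Move G x z := by
  obtain ⟨x', hx, hx'⟩ := exists_move_edist_le (m := 0) (by simpa using h)
  have : x' = z := by simpa using hx'
  exact this ▸ hx

namespace Expands

theorem one_le_radius (H : Expands G X d q y a₁ a₂ a₃ a₄ a₅) {r : ℕ} (hr : q ≤ y ^ 2 * d ^ r) :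
    1 ≤ r := by
  by_contra! h
  obtain rfl : r = 0 := by omega
  have h1 := H.two_le_y
  have h2 := H.pow_le_q (k := 3) (by norm_num)
  rw [pow_zero, mul_one] at hr
  have : y ^ 3 = y ^ 2 * y := by ring
  nlinarith [sq_nonneg y]

theorem pow_mul_le (H : Expands G X d q y a₁ a₂ a₃ a₄ a₅) {r : ℕ} (hr : d ^ r ≤ q * y ^ 6) :
    d ^ r * y ≤ q ^ 2 := by
  have hy := H.two_le_y
  have hq := H.two_le_q
  calc d ^ r * y ≤ q * y ^ 6 * y := by gcongr
    _ = q * y ^ 7 := by ring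
    _ ≤ q * q := by gcongr; exact H.pow_le_q (by norm_num)
    _ = q ^ 2 := by ring

/-- If few vertices of the sphere about the robber are not guarded, then the cops win with the help
of a team that can cover every small set of vertices. -/
theorem wins_of_small (H : Expands G X d q y a₁ a₂ a₃ a₄ a₅) {t : ℕ}
    (ht1 : d ^ (t - 1) ≤ q ^ 2 * y) (ht2 : q ^ 2 * y ≤ d ^ t) {ι O S : Type*} [Finite ι] [Finite O]
    [Finite S] (hO : ⌈q ^ 2⌉₊ ≤ Nat.card O) {g : ι → V}
    (hg : ∀ v ∉ X, ∀ U ⊆ ball G {v} (t - 1) \ X, 2 ≤ t → y ^ 5 * U.ncard ≤ a₂ * d ^ (t - 1) →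
      ∃ τ : ι → V, (∀ j, G.edist (g j) (τ j) ≤ t) ∧ U ⊆ Set.range τ)
    {v : V} {r : ℕ} {A : Set V} (hv : v ∉ X) (hr1 : q ≤ y ^ 2 * d ^ r) (hr2 : d ^ r ≤ q * y ^ 6)
    (hA : A ⊆ sphere G {v} r \ X) (hsmall : y ^ 5 * A.ncard ≤ d ^ r) {o : O → V}
    (ho : ∀ k, G.Reachable (o k) v) {c τ : S → V} (hc : ∀ j, G.edist (c j) (τ j) ≤ (r + 1 : ℕ))
    (hcov : sphere G {v} r ⊆ X ∪ A ∪ Set.range τ) :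
    Wins G (Sum.elim (Sum.elim ((↑) : X → V) o) (Sum.elim g c)) v := by
  classical
  have := H.finite
  have hy := H.two_le_y
  have hq := H.two_le_q
  have hd := H.d_pos
  have hd2 := H.two_le
  have ha2 := H.a₂_pos
  have hr := H.one_le_radius hr1
  -- The next radius `r' = t - 1 - r` is therefore positive; `g` reaches its targets in `t = r + r'
  -- + 1` moves.
  have hrt : r + 1 < t := by
    refine (pow_lt_pow_iff_right₀ (by linarith : 1 < d)).1 (lt_of_lt_of_le ?_ ht2)
    calc d ^ (r + 1) = d ^ r * d := pow_succ _ _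
      _ ≤ q * y ^ 6 * y := by gcongr; exact H.d_le
      _ = q * y ^ 6 * y := rfl
      _ < q * q * y := by
        have h7 := H.pow_le_q (k := 7) (by norm_num)
        have h6 : 0 < y ^ 6 := by positivity
        have : y ^ 6 < q := by
          have : y ^ 7 = y ^ 6 * y := by ring
          nlinarith
        gcongr
      _ = q ^ 2 * y := by ring
  obtain ⟨r', rfl⟩ : ∃ r', t = r + r' + 1 := ⟨t - 1 - r, by omega⟩
  simp only [Nat.add_sub_cancel] at ht1 hg
  have hr' : 1 ≤ r' := by omega
  have hdr : 0 < d ^ r := by positivity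
  have hr'2 : d ^ r' ≤ q * y ^ 6 := by
    have h1 : q * d ^ r' ≤ q * (q * y ^ 3) := by
      calc q * d ^ r' ≤ (y ^ 2 * d ^ r) * d ^ r' := by gcongr
        _ = y ^ 2 * d ^ (r + r') := by rw [pow_add]; ring
        _ ≤ y ^ 2 * (q ^ 2 * y) := by gcongr
        _ = q * (q * y ^ 3) := by ring
    have h2 := le_of_mul_le_mul_left h1 (by linarith)
    refine h2.trans ?_
    gcongr <;> linarith
  set U : Set V := (⋃ a ∈ A, sphere G {a} r') \ X with hU
  obtain ⟨τg, hτg, hτU⟩ := hg v hv U (by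
      rintro u ⟨hu, huX⟩
      simp only [Set.mem_iUnion] at hu
      obtain ⟨a, ha, hu⟩ := hu
      refine ⟨mem_ball_singleton.2 ?_, huX⟩
      calc G.edist v u ≤ G.edist v a + G.edist a u := SimpleGraph.edist_triangle
        _ = (r + r' : ℕ) := by
          rw [mem_sphere_singleton.1 (hA ha).1, mem_sphere_singleton.1 hu]; push_cast; rfl)
    (by omega) (by
      have h1 := H.ncard_iUnion_sphere_le (fun a ha => (hA ha).2) hr' (H.pow_mul_le hr'2)
      have h2 : (U.ncard : ℝ) ≤ (⋃ a ∈ A, sphere G {a} r').ncard := by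
        exact_mod_cast Set.ncard_le_ncard Set.sdiff_subset (Set.toFinite _)
      calc y ^ 5 * (U.ncard : ℝ) ≤ y ^ 5 * (A.ncard * (a₂ * d ^ r')) := by
            gcongr; exact h2.trans h1
        _ = (y ^ 5 * A.ncard) * (a₂ * d ^ r') := by ring
        _ ≤ d ^ r * (a₂ * d ^ r') := by gcongr
        _ = _ := by rw [pow_add]; ring)
  refine wins_of_occupy hr ((H.ncard_edist_lt_le_ceil hv hr2).trans (by simpa using hO)) ho
    (τ := Sum.elim τg τ) (Sum.elim (fun _ => r + r' + 1) fun _ => r + 1) ?_ ?_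
  · rintro (j | j)
    · exact hτg j
    · exact hc j
  intro b o' c' hb hbX ho' hc'
  rcases hcov (mem_sphere_singleton.2 hb) with (hbX' | hbA) | ⟨j, hj⟩
  · exact absurd hbX' hbX
  -- A second ball, now about `b`. The team `g` has used `r` of its `t` moves, so it is one move
  -- from its targets when the robber leaves this ball.
  · refine wins_of_occupy hr' ((H.ncard_edist_lt_le_ceil hbX hr'2).trans (by simpa using hO)) ho'
      (τ := Sum.elim τg (c' ∘ Sum.inr)) (Sum.elim (fun _ => r' + 1) fun _ => 0) ?_ ?_
    · rintro (j | j)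
      · refine (hc' (Sum.inl j)).trans ?_
        exact_mod_cast (by simp; omega)
      · simp
    · intro b' o'' c'' hb' hbX' _ hc''
      obtain ⟨j, hj⟩ := hτU (show b' ∈ U from
        ⟨Set.mem_biUnion hbA (mem_sphere_singleton.2 hb'), hbX'⟩)
      refine Wins.capture (Sum.inr (Sum.inl j)) (move_of_edist_le_one ?_)
      simpa [hj] using hc'' (Sum.inl j)
  · refine Wins.capture (Sum.inr (Sum.inr j)) (move_of_edist_le_one ?_)
    simpa [hj] using hc' (Sum.inr j)

/-- The lower bound, up to a factor `q ^ 2 * 2 ^ i`, for the sizes of the sets that make the unions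
of spheres accessible. -/
noncomputable def rate (a₂ a₃ a₄ a₅ : ℝ) : ℝ :=
  a₄ * min (√a₃ / a₂) (a₅ / (a₂ ^ 2 * (√a₃ / a₂)))

theorem rate_pos (H : Expands G X d q y a₁ a₂ a₃ a₄ a₅) : 0 < rate a₂ a₃ a₄ a₅ := by
  have h2 := H.a₂_pos
  have h3 := Real.sqrt_pos.2 H.a₃_pos
  have h4 := H.a₄_pos
  have h5 := H.a₅_pos
  rw [rate]
  positivity

/-- Entropy against probability for one missed target in round `i`. Bernoulli's inequality (3/2)^i ≥
1 + i/2 is enough: the exponent becomes 4 + 3i - (6 + 3i) = -2. -/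
theorem four_pow_mul_exp_le (i : ℕ) :
    8 * Real.exp 1 * 4 ^ i * Real.exp (-(6 * (3 / 2) ^ i)) ≤ Real.exp (-1) := by
  have h1 : 1 + (i : ℝ) * (1 / 2) ≤ (3 / 2) ^ i := by
    have := one_add_mul_le_pow (by norm_num : (-2 : ℝ) ≤ 1 / 2) i
    norm_num at this ⊢
    linarith
  have h2 : (8 : ℝ) ≤ Real.exp 3 := by
    have : Real.exp 3 = Real.exp 1 ^ 3 := by rw [← Real.exp_nat_mul]; norm_num
    rw [this]
    have h := Real.exp_one_gt_d9
    calc (8 : ℝ) = 2 ^ 3 := by norm_num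
      _ ≤ _ := by gcongr; linarith
  have h3 : (4 : ℝ) ^ i ≤ Real.exp (3 * i) := by
    rw [mul_comm, Real.exp_nat_mul]
    gcongr
    linarith
  calc 8 * Real.exp 1 * 4 ^ i * Real.exp (-(6 * (3 / 2) ^ i))
      ≤ Real.exp 3 * Real.exp 1 * Real.exp (3 * i) * Real.exp (-(6 * (1 + (i : ℝ) * (1 / 2)))) := by
        gcongr
    _ = Real.exp (-2) := by rw [← Real.exp_add, ← Real.exp_add, ← Real.exp_add]; congr 1; ring
    _ ≤ _ := Real.exp_le_exp.2 (by norm_num)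

theorem choose_mul_exp_le {N k : ℕ} {i : ℕ} {x : ℝ} (hk : 0 < k) (hN : N ≤ 8 * 4 ^ i * (k : ℝ))
    (hx : 6 * (3 / 2) ^ i * (k : ℝ) ≤ x) : N.choose k * Real.exp (-x) ≤ Real.exp (-k) := by
  have hk' : (0 : ℝ) < k := by exact_mod_cast hk
  have h1 : (N.choose k : ℝ) ≤ (8 * 4 ^ i) ^ k * Real.exp k := by
    calc (N.choose k : ℝ) ≤ N ^ k / k.factorial := Nat.choose_le_pow_div k N
      _ ≤ (8 * 4 ^ i * (k : ℝ)) ^ k / k.factorial := by gcongr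
      _ = (8 * 4 ^ i) ^ k * ((k : ℝ) ^ k / k.factorial) := by rw [mul_pow]; ring
      _ ≤ _ := by gcongr; exact Real.pow_div_factorial_le_exp _ hk'.le k
  calc N.choose k * Real.exp (-x)
      ≤ ((8 * 4 ^ i) ^ k * Real.exp k) * Real.exp (-(6 * (3 / 2) ^ i * (k : ℝ))) := by gcongr
    _ = (8 * Real.exp 1 * 4 ^ i * Real.exp (-(6 * (3 / 2) ^ i))) ^ k := by
        rw [mul_pow, mul_pow, mul_pow, mul_pow, ← Real.exp_nat_mul, ← Real.exp_nat_mul]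
        ring_nf
    _ ≤ (Real.exp (-1)) ^ k := by gcongr; exact four_pow_mul_exp_le i
    _ = Real.exp (-k) := by rw [← Real.exp_nat_mul]; congr 1; ring

/-- A team of cops that, for all `(v, A)` in a given family of limited size, can guard most of each
of the spheres of radius `r'` about the vertices of `A`. -/
theorem exists_round_team (H : Expands G X d q y a₁ a₂ a₃ a₄ a₅) {i r r' m : ℕ}
    (hi : (4 : ℝ) ^ i ≤ y ^ 6) (hr1 : q ≤ y ^ 2 * d ^ r) (hr2 : d ^ r ≤ q * y ^ 6)
    (hr1' : q ≤ y ^ 2 * d ^ r') (hr2' : d ^ r' ≤ q * y ^ 6)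
    (hρ1 : d ^ (r + r') < √a₃ / a₂ * q ^ 2 * 2 ^ i)
    (hρ2 : √a₃ / a₂ * q ^ 2 * 2 ^ i ≤ d ^ (r + r' + 1))
    (hm : 6 / rate a₂ a₃ a₄ a₅ * (3 / 4) ^ i * q ^ 2 ≤ m) (F : Set (V × Set V))
    (hFcard : F.ncard ≤ Nat.card V ^ (i + 1))
    (hF : ∀ p ∈ F, p.1 ∉ X ∧ p.2 ⊆ sphere G {p.1} r \ X ∧ p.2.ncard ≤ a₂ / 4 ^ i * d ^ r ∧
      d ^ r ≤ y ^ 5 * p.2.ncard) :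
    ∃ f : Fin m → V, ∀ p ∈ F, ∃ τ : Fin m → V,
      (∀ j, G.edist (f j) (τ j) ≤ (r + r' + 1 : ℕ)) ∧
      ∀ a ∈ p.2, ((sphere G {a} r' \ Set.range τ).ncard : ℝ) ≤ a₂ / 4 ^ (i + 1) * d ^ r' := by
  classical
  have := H.finite
  have := Fintype.ofFinite V
  have hy := H.two_le_y
  have hq := H.two_le_q
  have hd := H.d_pos
  have ha2 := H.a₂_pos
  have hr := H.one_le_radius hr1
  have hr' := H.one_le_radius hr1'
  have hc₁ := H.rate_pos
  set β := √a₃ / a₂ with hβ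
  set c₁ := rate a₂ a₃ a₄ a₅ with hc₁def
  have hβ0 : 0 < β := div_pos (Real.sqrt_pos.2 H.a₃_pos) ha2
  -- The reason for the value of `β`: with |U| ≤ a₂² β q² / 2^i and d^{r+r'} < β q² 2^i, the product
  -- is below a₃ n, as accessibility demands.
  have hβ2 : a₂ ^ 2 * β ^ 2 = a₃ := by
    rw [hβ, div_pow, Real.sq_sqrt H.a₃_pos.le]; field_simp
  have hn : (Fintype.card V : ℝ) = q ^ 4 := by rw [← H.card_eq, Nat.card_eq_fintype_card]
  have : Nonempty V := by
    rw [← Fintype.card_pos_iff, ← Nat.cast_pos (α := ℝ), hn]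
    positivity
  have h4 : (4 : ℝ) ^ i = 2 ^ i * 2 ^ i := by rw [← mul_pow]; norm_num
  have hdrr : 0 < d ^ (r + r') := by positivity
  have hUcard : ∀ p ∈ F, (2 : ℝ) ^ i * (⋃ a ∈ p.2, sphere G {a} r').ncard ≤
      a₂ ^ 2 * β * q ^ 2 := by
    intro p hp
    obtain ⟨hpX, hpA, hp1, hp2⟩ := hF p hp
    have h1 := H.ncard_iUnion_sphere_le (fun a ha => (hpA ha).2) hr' (H.pow_mul_le hr2')
    have h2i : (0 : ℝ) < 2 ^ i := by positivity
    calc (2 : ℝ) ^ i * (⋃ a ∈ p.2, sphere G {a} r').ncard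
        ≤ 2 ^ i * (p.2.ncard * (a₂ * d ^ r')) := by gcongr
      _ ≤ 2 ^ i * ((a₂ / 4 ^ i * d ^ r) * (a₂ * d ^ r')) := by gcongr
      _ = a₂ ^ 2 * d ^ (r + r') / 2 ^ i := by rw [h4, pow_add]; field_simp
      _ ≤ a₂ ^ 2 * (β * q ^ 2 * 2 ^ i) / 2 ^ i := by gcongr
      _ = _ := by field_simp
  have hacc : ∀ p ∈ F, ∃ Q : Set V, ∃ W : V → Set V,
      (∀ a ∈ p.2, y ^ 10 * (sphere G {a} r' ∩ Q).ncard ≤ q) ∧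
      (((⋃ a ∈ p.2, sphere G {a} r') \ Q).PairwiseDisjoint W) ∧
      ∀ w ∈ (⋃ a ∈ p.2, sphere G {a} r') \ Q, W w ⊆ ball G {w} (r + r' + 1) ∧
        c₁ * q ^ 2 * 2 ^ i ≤ (W w).ncard := by
    intro p hp
    obtain ⟨hpX, hpA, hp1, hp2⟩ := hF p hp
    set U := ⋃ a ∈ p.2, sphere G {a} r' with hU
    have hA0 : p.2.Nonempty := by
      rw [Set.nonempty_iff_ne_empty]
      intro h
      rw [h] at hp2
      have : 0 < d ^ r := by positivity
      simp at hp2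
      linarith
    have hU0 : (0 : ℝ) < U.ncard := by
      obtain ⟨a, ha⟩ := hA0
      have h1 := (H.sphere_bounds (hpA ha).2 hr' (H.pow_mul_le hr2')).1
      have h2 : ((sphere G {a} r').ncard : ℝ) ≤ U.ncard := by
        exact_mod_cast Set.ncard_le_ncard
          (Set.subset_biUnion_of_mem (u := fun a => sphere G {a} r') ha) (Set.toFinite _)
      have h3 : 0 < a₁ * d ^ r' := mul_pos H.a₁_pos (by positivity)
      linarith
    obtain ⟨Q, hQ, W, hW1, hW2⟩ := H.accessible r r' hr1 hr2 hr1' hr2' p.1 hpX p.2 hpA (by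
        calc q ≤ y ^ 2 * d ^ r := hr1
          _ ≤ y ^ 2 * (y ^ 5 * p.2.ncard) := by gcongr
          _ = y ^ 7 * p.2.ncard := by ring
          _ ≤ y ^ 8 * p.2.ncard := by gcongr <;> linarith) (by
        rw [lt_div_iff₀ hU0, ← hβ2]
        calc d ^ (r + r') * (U.ncard : ℝ) < (β * q ^ 2 * 2 ^ i) * U.ncard := by gcongr
          _ = β * q ^ 2 * (2 ^ i * U.ncard) := by ring
          _ ≤ β * q ^ 2 * (a₂ ^ 2 * β * q ^ 2) :=
            mul_le_mul_of_nonneg_left (hUcard p hp) (by positivity)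
          _ = _ := by ring)
    refine ⟨Q, W, hQ, hW1, fun w hw => ⟨(hW2 w hw).1, le_trans ?_ (hW2 w hw).2⟩⟩
    have hUQ0 : (0 : ℝ) < (U \ Q).ncard := by
      exact_mod_cast (Set.ncard_pos (Set.toFinite _)).2 ⟨w, hw⟩
    have hUQ : ((U \ Q).ncard : ℝ) ≤ U.ncard := by
      exact_mod_cast Set.ncard_le_ncard Set.sdiff_subset (Set.toFinite _)
    -- The two terms of the minimum in `rate` answer to the two terms in the definition of
    -- accessibility.
    rw [hc₁def, rate, mul_assoc, mul_assoc]
    refine mul_le_mul_of_nonneg_left (le_min ?_ ?_) H.a₄_pos.le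
    · calc min β (a₅ / (a₂ ^ 2 * β)) * (q ^ 2 * 2 ^ i) ≤ β * (q ^ 2 * 2 ^ i) := by
            gcongr; exact min_le_left _ _
        _ ≤ _ := by rw [← mul_assoc]; exact hρ2
    · have h5 := H.a₅_pos
      rw [H.card_eq, le_div_iff₀ hUQ0]
      calc min β (a₅ / (a₂ ^ 2 * β)) * (q ^ 2 * 2 ^ i) * (U \ Q).ncard
          ≤ (a₅ / (a₂ ^ 2 * β)) * (q ^ 2 * 2 ^ i) * U.ncard := by
            gcongr; exact min_le_right _ _
        _ = (a₅ / (a₂ ^ 2 * β)) * q ^ 2 * (2 ^ i * U.ncard) := by ring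
        _ ≤ (a₅ / (a₂ ^ 2 * β)) * q ^ 2 * (a₂ ^ 2 * β * q ^ 2) :=
            mul_le_mul_of_nonneg_left (hUcard p hp) (by positivity)
        _ = a₅ * q ^ 4 := by field_simp
  choose! Q W hQ hWd hW using hacc
  -- The number of vertices that may stay uncovered; one half is for `Q`, the other for targets
  -- missed by the random team.
  set e : ℝ := a₂ / 4 ^ (i + 1) * d ^ r' with he
  have he0 : 0 < e := by positivity
  have heq : q ≤ e / 2 * y ^ 9 := by
    have h8 := H.le_a₂
    calc q ≤ y ^ 2 * d ^ r' := hr1'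
      _ = 8 * (1 / 8) * y ^ 2 * d ^ r' := by ring
      _ ≤ (y * a₂) * (1 / 8) * y ^ 2 * d ^ r' := by gcongr
      _ = (a₂ / 8 * d ^ r') * y ^ 3 := by ring
      _ = (e / 2 * 4 ^ i) * y ^ 3 := by rw [he]; field_simp; ring
      _ ≤ (e / 2 * y ^ 6) * y ^ 3 := by gcongr
      _ = _ := by ring
  set k : ℕ := ⌊e / 2⌋₊ + 1 with hk
  have hk1 : e / 2 < k := by rw [hk]; exact_mod_cast Nat.lt_floor_add_one _
  -- The union bound runs over at most n^{i+2} pairs, each failing with probability at most exp(-k).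
  -- It succeeds because k > e/2 ≥ y^8, which dominates (i + 2) log n.
  let I : Finset ((V × Set V) × V) := {x | x.1 ∈ F ∧ x.2 ∈ x.1.2}
  have hI : I.card ≤ Nat.card V ^ (i + 2) := by
    have h1 : I ⊆ F.toFinset ×ˢ Finset.univ := by
      intro x hx
      simp only [I, Finset.mem_filter] at hx
      simpa using hx.2.1
    refine (Finset.card_le_card h1).trans ?_
    rw [Finset.card_product, Finset.card_univ, ← Set.ncard_eq_toFinset_card',
      ← Nat.card_eq_fintype_card, pow_succ]
    gcongr
  obtain ⟨f, hf⟩ := exists_function_few_missed (m := m) (N := ⌊a₂ * d ^ r'⌋₊) (k := k)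
    (ω := c₁ * q ^ 2 * 2 ^ i) I (fun x => (sphere G {x.2} r' \ Q x.1).toFinset)
    (fun x w => (W x.1 w).toFinset) (by
      rintro ⟨p, a⟩ hx
      simp only [I, Finset.mem_filter, Finset.mem_univ, true_and] at hx
      intro w hw w' hw' hne
      simp only [Set.coe_toFinset] at hw hw'
      have := hWd p hx.1 ⟨Set.mem_biUnion hx.2 hw.1, hw.2⟩ ⟨Set.mem_biUnion hx.2 hw'.1, hw'.2⟩ hne
      simpa [Function.onFun] using this) (by
      rintro ⟨p, a⟩ hx w hw
      simp only [I, Finset.mem_filter, Finset.mem_univ, true_and] at hx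
      simp only [Set.mem_toFinset] at hw
      have := (hW p hx.1 w ⟨Set.mem_biUnion hx.2 hw.1, hw.2⟩).2
      rwa [Set.ncard_eq_toFinset_card'] at this) (by
      rintro ⟨p, a⟩ hx
      simp only [I, Finset.mem_filter, Finset.mem_univ, true_and] at hx
      refine Nat.le_floor ?_
      have h1 := (H.sphere_bounds ((hF p hx.1).2.1 hx.2).2 hr' (H.pow_mul_le hr2')).2
      refine le_trans ?_ h1
      rw [← Set.ncard_eq_toFinset_card']
      exact_mod_cast Set.ncard_le_ncard Set.sdiff_subset (Set.toFinite _)) (by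
      have h1 : (((⌊a₂ * d ^ r'⌋₊).choose k : ℕ) : ℝ) *
          Real.exp (-(m * (k * (c₁ * q ^ 2 * 2 ^ i)) / Fintype.card V)) ≤ Real.exp (-k) := by
        refine choose_mul_exp_le (i := i) (by omega) ?_ ?_
        · refine (Nat.floor_le (by positivity)).trans ?_
          calc a₂ * d ^ r' = 8 * 4 ^ i * (e / 2) := by rw [he, pow_succ]; field_simp; norm_num
            _ ≤ _ := by gcongr
        · rw [hn]
          have h32 : (3 / 2 : ℝ) ^ i = (3 / 4) ^ i * 2 ^ i := by rw [← mul_pow]; norm_num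
          calc 6 * (3 / 2) ^ i * (k : ℝ) = (6 / c₁ * (3 / 4) ^ i * q ^ 2) *
                (k * (c₁ * q ^ 2 * 2 ^ i)) / q ^ 4 := by rw [h32]; field_simp
            _ ≤ _ := by gcongr
      have h2 : (I.card : ℝ) ≤ Real.exp (y * (i + 2)) := by
        calc (I.card : ℝ) ≤ (Nat.card V : ℝ) ^ (i + 2) := by exact_mod_cast hI
          _ = (Real.exp (Real.log (q ^ 4))) ^ (i + 2) := by
            rw [Real.exp_log (by positivity), H.card_eq]
          _ ≤ (Real.exp y) ^ (i + 2) := by gcongr; exact H.log_le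
          _ = _ := by rw [← Real.exp_nat_mul]; congr 1; push_cast; ring
      have h3 : y * (i + 2) < k := by
        have hi4 : (i : ℝ) ≤ y ^ 6 := by
          refine le_trans ?_ hi
          exact_mod_cast (Nat.lt_pow_self (by norm_num : 1 < 4)).le
        have hy6 : 2 ≤ y ^ 6 := hy.trans (le_self_pow₀ (by linarith) (by norm_num))
        have h5 : y * (i + 2) ≤ y ^ 8 := by
          calc y * (i + 2) ≤ y * (y ^ 6 + y ^ 6) := by gcongr
            _ = 2 * y ^ 7 := by ring
            _ ≤ y * y ^ 7 := by gcongr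
            _ = y ^ 8 := by ring
        have h6 : y ^ 17 ≤ e / 2 * y ^ 9 := (H.pow_le_q (by norm_num)).trans heq
        have h7 : y ^ 8 ≤ e / 2 := by
          have : y ^ 17 = y ^ 8 * y ^ 9 := by ring
          rw [this] at h6
          exact le_of_mul_le_mul_right h6 (by positivity)
        linarith
      calc (I.card : ℝ) * _ ≤ Real.exp (y * (i + 2)) * Real.exp (-k) := by gcongr
        _ = Real.exp (y * (i + 2) - k) := by rw [← Real.exp_add]; rfl
        _ < 1 := by rw [Real.exp_lt_one_iff]; linarith)
  refine ⟨f, fun p hp => ?_⟩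
  obtain ⟨τ, hτ, hτU⟩ := exists_targets_of_disjoint (f := f) (hWd p hp)
    fun w hw => (hW p hp w hw).1
  refine ⟨τ, hτ, fun a ha => ?_⟩
  have hlt := hf (p, a) (by simp [I, hp, ha])
  have hsub : sphere G {a} r' \ Set.range τ ⊆ (sphere G {a} r' ∩ Q p) ∪
      (({w ∈ (sphere G {a} r' \ Q p).toFinset | ∀ j, f j ∉ (W p w).toFinset} : Finset V) :
        Set V) := by
    rintro w ⟨hw, hwτ⟩
    by_cases hwQ : w ∈ Q p
    · exact Or.inl ⟨hw, hwQ⟩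
    · right
      simp only [Finset.coe_filter, Set.mem_toFinset]
      refine ⟨⟨hw, hwQ⟩, fun j hj => hwτ (hτU w ⟨Set.mem_biUnion ha hw, hwQ⟩ ⟨j, hj⟩)⟩
  have h1 := (Set.ncard_le_ncard hsub (Set.toFinite _)).trans (Set.ncard_union_le _ _)
  rw [Set.ncard_coe_finset] at h1
  have h2 : ((sphere G {a} r' \ Set.range τ).ncard : ℝ) ≤
      (sphere G {a} r' ∩ Q p).ncard + ⌊e / 2⌋₊ := by
    have : (sphere G {a} r' \ Set.range τ).ncard ≤ (sphere G {a} r' ∩ Q p).ncard + ⌊e / 2⌋₊ := by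
      dsimp only at hlt
      omega
    exact_mod_cast this
  have h3 : ((sphere G {a} r' ∩ Q p).ncard : ℝ) ≤ e / 2 := by
    have h4 := (hQ p hp a ha).trans heq
    have h5 : y ^ 10 = y ^ 9 * y := by ring
    have h6 : 0 < y ^ 9 := by positivity
    have h7 : ((sphere G {a} r' ∩ Q p).ncard : ℝ) * y ≤ e / 2 := by
      refine le_of_mul_le_mul_right (le_trans (le_of_eq ?_) h4) h6
      rw [h5]; ring
    have h8 : (0 : ℝ) ≤ (sphere G {a} r' ∩ Q p).ncard := Nat.cast_nonneg _
    nlinarith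
  have h4 : (⌊e / 2⌋₊ : ℝ) ≤ e / 2 := Nat.floor_le (by positivity)
  linarith

end Expands

theorem exists_pow_lt_le {d x : ℝ} (hd : 1 < d) (hx : 1 < x) :
    ∃ k : ℕ, d ^ k < x ∧ x ≤ d ^ (k + 1) := by
  classical
  have h : ∃ k : ℕ, x ≤ d ^ k := (pow_unbounded_of_one_lt x hd).imp fun _ h => h.le
  have h0 : Nat.find h ≠ 0 := fun h0 => by
    have := Nat.find_spec h
    rw [h0, pow_zero] at this
    linarith
  refine ⟨Nat.find h - 1, not_le.1 (Nat.find_min h (by omega)), ?_⟩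
  rw [Nat.sub_add_cancel (by omega)]
  exact Nat.find_spec h

namespace Expands

theorem nonempty (H : Expands G X d q y a₁ a₂ a₃ a₄ a₅) : Nonempty V := by
  by_contra! h
  have h1 := H.card_eq
  rw [Nat.card_of_isEmpty] at h1
  have h2 : 0 < q ^ 4 := by have := H.two_le_q; positivity
  simp [← h1] at h2

/-- The radii for the rounds of the game. -/
theorem exists_radii (H : Expands G X d q y a₁ a₂ a₃ a₄ a₅) :
    ∃ (r₀ : ℕ) (ρ : ℕ → ℕ), q ≤ y ^ 2 * d ^ r₀ ∧ 2 * r₀ ≤ ρ 0 ∧ Monotone ρ ∧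
      ∀ i, d ^ ρ i < √a₃ / a₂ * q ^ 2 * 2 ^ i ∧ √a₃ / a₂ * q ^ 2 * 2 ^ i ≤ d ^ (ρ i + 1) := by
  have hy := H.two_le_y
  have hq := H.two_le_q
  have hd := H.two_le
  have hd1 : 1 < d := by linarith
  have hβ := H.le_ratio
  set β := √a₃ / a₂
  have hβ0 : 0 < β := by
    by_contra! h
    nlinarith
  have hy2 : y ^ 2 * y ≤ q := by
    have := H.pow_le_q (k := 3) (by norm_num)
    calc y ^ 2 * y = y ^ 3 := by ring
      _ ≤ q := this
  have hβq : q < β * q ^ 2 := by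
    have h1 : y * y < q := by nlinarith
    have h2 : 1 < β * q := by
      by_contra! h
      nlinarith
    nlinarith
  have hx : ∀ i : ℕ, 1 < β * q ^ 2 * 2 ^ i := fun i => by
    have : (1 : ℝ) ≤ 2 ^ i := one_le_pow₀ (by norm_num)
    nlinarith
  choose ρ hρ1 hρ2 using fun i => exists_pow_lt_le hd1 (hx i)
  obtain ⟨k, hk1, hk2⟩ := exists_pow_lt_le hd1 (x := q / y ^ 2) (by
    rw [lt_div_iff₀ (by positivity)]; nlinarith)
  rw [lt_div_iff₀ (by positivity)] at hk1
  rw [div_le_iff₀ (by positivity)] at hk2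
  refine ⟨k + 1, ρ, by linarith, ?_, ?_, fun i => ⟨hρ1 i, hρ2 i⟩⟩
  · have h1 : d ^ (k + 1) * y ≤ q := by
      have hdk : 0 < d ^ k := by positivity
      calc d ^ (k + 1) * y = d ^ k * d * y := by rw [pow_succ]
        _ ≤ d ^ k * y * y := by gcongr; exact H.d_le
        _ = d ^ k * y ^ 2 := by ring
        _ ≤ q := hk1.le
    have h2 : d ^ (2 * (k + 1)) < d ^ (ρ 0 + 1) := by
      refine lt_of_lt_of_le ?_ (hρ2 0)
      rw [pow_zero, mul_one]
      have hdk : 0 < d ^ (k + 1) := by positivity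
      have h3 : d ^ (2 * (k + 1)) = d ^ (k + 1) * d ^ (k + 1) := by rw [two_mul, pow_add]
      have h4 : d ^ (2 * (k + 1)) * y ^ 2 ≤ q ^ 2 := by
        calc d ^ (2 * (k + 1)) * y ^ 2 = (d ^ (k + 1) * y) ^ 2 := by rw [h3]; ring
          _ ≤ q ^ 2 := by gcongr
      have h5 : q ^ 2 < β * q ^ 2 * y ^ 2 := by
        have : 1 < β * y ^ 2 := by nlinarith
        have : 0 < q ^ 2 := by positivity
        nlinarith
      exact lt_of_mul_lt_mul_right (h4.trans_lt h5) (by positivity)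
    have := (pow_lt_pow_iff_right₀ hd1).1 h2
    omega
  · refine monotone_nat_of_le_succ fun i => ?_
    have h : d ^ ρ i < d ^ (ρ (i + 1) + 1) := by
      refine (hρ1 i).trans_le (le_trans ?_ (hρ2 (i + 1)))
      gcongr <;> norm_num
    have := (pow_lt_pow_iff_right₀ hd1).1 h
    omega

/-- The complementary radius `R - r` is at least `r₀`, so d^r ≤ d^R / d^{r₀}, and d^{r₀} is at least
q / y². -/
theorem radius_window (H : Expands G X d q y a₁ a₂ a₃ a₄ a₅) {i r₀ r R : ℕ}
    (hr₀ : q ≤ y ^ 2 * d ^ r₀) (hi : (4 : ℝ) ^ i ≤ y ^ 6)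
    (hR : d ^ R < √a₃ / a₂ * q ^ 2 * 2 ^ i) (h1 : r₀ ≤ r) (h2 : r + r₀ ≤ R) :
    q ≤ y ^ 2 * d ^ r ∧ d ^ r ≤ q * y ^ 6 := by
  have hy := H.two_le_y
  have hq := H.two_le_q
  have hd := H.two_le
  have hdp := H.d_pos
  have hd1 : 1 ≤ d := by linarith
  refine ⟨hr₀.trans (by gcongr), ?_⟩
  have h2i : (2 : ℝ) ^ i ≤ y ^ 3 := by
    refine le_of_pow_le_pow_left₀ two_ne_zero (by positivity) ?_
    calc ((2 : ℝ) ^ i) ^ 2 = 4 ^ i := by rw [← pow_mul, mul_comm, pow_mul]; norm_num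
      _ ≤ y ^ 6 := hi
      _ = (y ^ 3) ^ 2 := by ring
  have h3 : d ^ r * q ≤ (q * y ^ 6) * q := by
    calc d ^ r * q ≤ d ^ r * (y ^ 2 * d ^ r₀) := by gcongr
      _ = y ^ 2 * d ^ (r + r₀) := by rw [pow_add]; ring
      _ ≤ y ^ 2 * d ^ R := by gcongr
      _ ≤ y ^ 2 * (√a₃ / a₂ * q ^ 2 * 2 ^ i) := by gcongr
      _ ≤ y ^ 2 * (y * q ^ 2 * y ^ 3) := by gcongr; exact H.ratio_le
      _ = _ := by ring
  exact le_of_mul_le_mul_right h3 (by linarith)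

/-- Teams of cops for all rounds from round `i` on, for a family of possible positions `(v, A)` of
the robber on `v` at the start of round `i`, where all vertices of the sphere of radius `r` about
`v` outside of `A` are guarded. -/
theorem exists_teams (H : Expands G X d q y a₁ a₂ a₃ a₄ a₅) {t : ℕ}
    (ht1 : d ^ (t - 1) ≤ q ^ 2 * y) (ht2 : q ^ 2 * y ≤ d ^ t) {g : Fin ⌈q ^ 2⌉₊ → V}
    (hg : ∀ v ∉ X, ∀ U ⊆ ball G {v} (t - 1) \ X, 2 ≤ t → y ^ 5 * U.ncard ≤ a₂ * d ^ (t - 1) →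
      ∃ τ : Fin ⌈q ^ 2⌉₊ → V, (∀ j, G.edist (g j) (τ j) ≤ t) ∧ U ⊆ Set.range τ)
    {r₀ : ℕ} {ρ : ℕ → ℕ} (hr₀ : q ≤ y ^ 2 * d ^ r₀) (hρm : Monotone ρ)
    (hρ : ∀ i, d ^ ρ i < √a₃ / a₂ * q ^ 2 * 2 ^ i ∧ √a₃ / a₂ * q ^ 2 * 2 ^ i ≤ d ^ (ρ i + 1))
    {M : ℕ} (hM1 : (4 : ℝ) ^ M ≤ y ^ 6) (hM2 : y ^ 6 ≤ 4 ^ (M + 1)) {m : ℕ → ℕ}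
    (hm : ∀ i, 6 / rate a₂ a₃ a₄ a₅ * (3 / 4) ^ i * q ^ 2 ≤ m i) :
    ∀ k i : ℕ, i + k = M → ∀ r : ℕ, r₀ ≤ r → r + r₀ ≤ ρ i → ∀ F : Set (V × Set V),
      F.ncard ≤ Nat.card V ^ (i + 1) →
      (∀ p ∈ F, p.1 ∉ X ∧ p.2 ⊆ sphere G {p.1} r \ X ∧ p.2.ncard ≤ a₂ / 4 ^ i * d ^ r) →
      ∃ (s : ℕ) (h : Fin s → V), s ≤ ∑ j ∈ Finset.range k, m (i + j) ∧
        ∀ p ∈ F, ∀ (S : Type) [Finite S] (o : Fin ⌈q ^ 2⌉₊ → V) (c τ : S → V),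
          (∀ k, G.Reachable (o k) p.1) → (∀ j, G.edist (c j) (τ j) ≤ (r + 1 : ℕ)) →
          sphere G {p.1} r ⊆ X ∪ p.2 ∪ Set.range τ →
          Wins G (Sum.elim (Sum.elim ((↑) : X → V) o) (Sum.elim g (Sum.elim c h))) p.1 := by
  classical
  have := H.finite
  have hy := H.two_le_y
  have hd := H.d_pos
  have ha2 := H.a₂_pos
  have hsmall : ∀ {i r : ℕ} {p : V × Set V} {s : ℕ} {h : Fin s → V}, i ≤ M → r₀ ≤ r →
      r + r₀ ≤ ρ i → p.1 ∉ X → p.2 ⊆ sphere G {p.1} r \ X → y ^ 5 * p.2.ncard ≤ d ^ r →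
      ∀ (S : Type) [Finite S] (o : Fin ⌈q ^ 2⌉₊ → V) (c τ : S → V),
        (∀ k, G.Reachable (o k) p.1) → (∀ j, G.edist (c j) (τ j) ≤ (r + 1 : ℕ)) →
        sphere G {p.1} r ⊆ X ∪ p.2 ∪ Set.range τ →
        Wins G (Sum.elim (Sum.elim ((↑) : X → V) o) (Sum.elim g (Sum.elim c h))) p.1 := by
    intro i r p s h hi hr1 hr2 hpX hpA hA S _ o c τ ho hc hcov
    have hi4 : (4 : ℝ) ^ i ≤ y ^ 6 :=
      (pow_le_pow_right₀ (by norm_num) hi).trans hM1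
    have hw := H.radius_window hr₀ hi4 (hρ i).1 hr1 hr2
    refine H.wins_of_small ht1 ht2 (by simp) hg hpX hw.1 hw.2 hpA hA ho
      (c := Sum.elim c h) (τ := Sum.elim τ h) ?_ ?_
    · rintro (j | j)
      · exact hc j
      · simp
    · refine hcov.trans (Set.union_subset_union_right _ ?_)
      rintro _ ⟨j, rfl⟩
      exact ⟨Sum.inl j, rfl⟩
  intro k
  induction k with
  | zero =>
    intro i hi r hr1 hr2 F _ hF
    obtain rfl : i = M := by omega
    refine ⟨0, Fin.elim0, by simp, fun p hp S _ o c τ ho hc hcov => ?_⟩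
    obtain ⟨hpX, hpA, hA⟩ := hF p hp
    refine hsmall le_rfl hr1 hr2 hpX hpA ?_ S o c τ ho hc hcov
    -- After `M` rounds the factor 4^M, of order y^6, has made the exceptional set small enough for
    -- the team `g`.
    have h1 : y ^ 5 * a₂ ≤ 4 ^ i := by
      have h8 := H.a₂_le
      have h9 : y ^ 6 ≤ 4 ^ i * 4 := by rwa [pow_succ] at hM2
      have h10 : y ^ 6 = y ^ 5 * y := by ring
      have h11 : 0 < y ^ 5 := by positivity
      nlinarith
    calc y ^ 5 * (p.2.ncard : ℝ) ≤ y ^ 5 * (a₂ / 4 ^ i * d ^ r) := by gcongr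
      _ = (y ^ 5 * a₂) / 4 ^ i * d ^ r := by ring
      _ ≤ 1 * d ^ r := by gcongr; rw [div_le_one (by positivity)]; exact h1
      _ = _ := one_mul _
  | succ k ih =>
    intro i hi r hr1 hr2 F hFcard hF
    have hi4 : (4 : ℝ) ^ i ≤ y ^ 6 :=
      (pow_le_pow_right₀ (by norm_num) (by omega)).trans hM1
    -- Consecutive radii add up to `ρ i`. Both invariants pass on to `r'`: `r + r₀ ≤ ρ i` gives `r₀
    -- ≤ r'`, and `r₀ ≤ r` with monotonicity gives `r' + r₀ ≤ ρ (i + 1)`.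
    obtain ⟨r', hr'⟩ : ∃ r', ρ i = r + r' := ⟨ρ i - r, by omega⟩
    have hw := H.radius_window hr₀ hi4 (hρ i).1 hr1 hr2
    have hw' := H.radius_window hr₀ hi4 (hρ i).1 (r := r') (by omega) (by omega)
    have hr := H.one_le_radius hw.1
    set F₁ : Set (V × Set V) := {p ∈ F | d ^ r ≤ y ^ 5 * p.2.ncard} with hF₁
    have hF₁F : F₁ ⊆ F := fun p hp => hp.1
    have hF₁card : F₁.ncard ≤ Nat.card V ^ (i + 1) :=
      (Set.ncard_le_ncard hF₁F (Set.toFinite _)).trans hFcard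
    obtain ⟨f, hf⟩ := H.exists_round_team hi4 hw.1 hw.2 hw'.1 hw'.2 (hr' ▸ (hρ i).1)
      (hr' ▸ (hρ i).2) (hm i) F₁ hF₁card fun p hp =>
        ⟨(hF p hp.1).1, (hF p hp.1).2.1, (hF p hp.1).2.2, hp.2⟩
    have := H.nonempty
    choose! τf hτf hτA using hf
    -- The new position depends only on the old one and on the vertex where the robber emerges, so
    -- each round multiplies the number of positions by at most n.
    set next : (V × Set V) × V → V × Set V := fun x =>
      (x.2, sphere G {x.2} r' \ (X ∪ Set.range (τf x.1))) with hnext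
    obtain ⟨s, h, hs, hwin⟩ := ih (i + 1) (by omega) r' (by omega)
      (by have := hρm (Nat.le_succ i); simp only [Nat.succ_eq_add_one] at this; omega)
      (next '' {x | x.1 ∈ F₁ ∧ x.2 ∈ x.1.2}) (by
        refine (Set.ncard_image_le (Set.toFinite _)).trans ?_
        refine (Set.ncard_le_ncard (t := F₁ ×ˢ Set.univ) (fun x hx => ⟨hx.1, trivial⟩)
          (Set.toFinite _)).trans ?_
        rw [Set.ncard_prod, Set.ncard_univ, pow_succ _ (i + 1)]
        gcongr) (by
        rintro _ ⟨⟨p, a⟩, ⟨hp, ha⟩, rfl⟩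
        refine ⟨((hF p hp.1).2.1 ha).2, fun w hw => ⟨hw.1, fun hX => hw.2 (Or.inl hX)⟩, ?_⟩
        refine le_trans ?_ (hτA p hp a ha)
        exact_mod_cast Set.ncard_le_ncard
          (Set.sdiff_subset_sdiff_right Set.subset_union_right) (Set.toFinite _))
    refine ⟨m i + s, Sum.elim f h ∘ finSumFinEquiv.symm, ?_, ?_⟩
    · rw [Finset.sum_range_succ', add_comm]
      have : ∑ j ∈ Finset.range k, m (i + (j + 1)) = ∑ j ∈ Finset.range k, m (i + 1 + j) :=
        Finset.sum_congr rfl fun j _ => by rw [add_right_comm, add_assoc]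
      rw [this]
      exact Nat.add_le_add_right hs _
    intro p hp S _ o c τ ho hc hcov
    obtain ⟨hpX, hpA, _⟩ := hF p hp
    by_cases hpF : p ∈ F₁
    swap
    · refine hsmall (by omega) hr1 hr2 hpX hpA ?_ S o c τ ho hc hcov
      by_contra! hcon
      exact hpF ⟨hp, hcon.le⟩
    suffices hmain : Wins G (Sum.elim (Sum.elim ((↑) : X → V) o)
        (Sum.elim g (Sum.elim c (Sum.elim f h)))) p.1 by
      convert hmain.comp_equiv (Equiv.sumCongr (Equiv.refl (X ⊕ Fin ⌈q ^ 2⌉₊))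
        (Equiv.sumCongr (Equiv.refl (Fin ⌈q ^ 2⌉₊))
          (Equiv.sumCongr (Equiv.refl S) finSumFinEquiv.symm))) using 1
      ext (x | j | j | j) <;> rfl
    refine wins_of_occupy hr (H.ncard_edist_lt_le_ceil hpX hw.2) ho
      (τ := Sum.elim g (Sum.elim τ (Sum.elim (τf p) h)))
      -- The budget 0 keeps `g` and the teams `h` of later rounds at their initial places.
      (Sum.elim 0 (Sum.elim (fun _ => r + 1) (Sum.elim (fun _ => r + r' + 1) 0))) ?_ ?_
    · rintro (j | j | j | j)
      · simp
      · exact hc j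
      · exact hτf p hpF j
      · simp
    intro b o' c' hb hbX ho' hc'
    rcases hcov (mem_sphere_singleton.2 hb) with (hbX' | hbA) | ⟨j, hj⟩
    · exact absurd hbX' hbX
    -- The cops of earlier rounds are kept as idle ones, with their present places as targets; only
    -- the team `f` guards the new sphere.
    · have hwb := hwin (next (p, b)) ⟨(p, b), ⟨hpF, hbA⟩, rfl⟩ (S ⊕ Fin (m i)) o'
        (Sum.elim (fun j => c' (Sum.inr (Sum.inl j)))
          fun j => c' (Sum.inr (Sum.inr (Sum.inl j))))
        (Sum.elim (fun j => c' (Sum.inr (Sum.inl j))) (τf p)) ho' (by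
          rintro (j | j)
          · simp
          · refine (hc' (Sum.inr (Sum.inr (Sum.inl j)))).trans ?_
            exact_mod_cast (by simp; omega)) (by
          intro w hw
          by_cases hwX : w ∈ X ∪ Set.range (τf p)
          · rcases hwX with hwX | ⟨j, hj⟩
            · exact Or.inl (Or.inl hwX)
            · exact Or.inr ⟨Sum.inr j, hj⟩
          · exact Or.inl (Or.inr ⟨hw, hwX⟩))
      convert hwb.comp_equiv (Equiv.sumCongr (Equiv.refl (X ⊕ Fin ⌈q ^ 2⌉₊))
        (Equiv.sumCongr (Equiv.refl (Fin ⌈q ^ 2⌉₊))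
          (Equiv.sumAssoc S (Fin (m i)) (Fin s)).symm)) using 1
      ext (x | j | j | j | j)
      · rfl
      · simpa using hc' (Sum.inl j)
      · rfl
      · rfl
      · simpa using hc' (Sum.inr (Sum.inr (Sum.inr j)))
    · refine Wins.capture (Sum.inr (Sum.inr (Sum.inl j))) (move_of_edist_le_one ?_)
      simpa [hj] using hc' (Sum.inr (Sum.inl j))

/-- The cops are those on X, two teams of ⌈q²⌉, and the round teams, for which the series of (3/4)^i
gives the factor 4 in 24 = 4 · 6; the constant 5 also absorbs the rounding. -/
theorem copNumber_le (H : Expands G X d q y a₁ a₂ a₃ a₄ a₅) {K : ℝ} (hX : X.ncard ≤ K * q ^ 2)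
    (hcomp : ∃ c : G.ConnectedComponent, Xᶜ ⊆ c.supp) :
    copNumber G ≤ (K + 5 + 24 / rate a₂ a₃ a₄ a₅) * q ^ 2 := by
  classical
  have := H.finite
  have hq := H.two_le_q
  have hy := H.two_le_y
  have hd := H.d_pos
  have hrate := H.rate_pos
  rcases Set.eq_empty_or_nonempty Xᶜ with hXe | ⟨x₀, hx₀⟩
  · have h1 : copNumber G ≤ X.ncard := by
      rw [Set.compl_empty_iff.1 hXe, Set.ncard_univ]
      exact Nat.sInf_le (copsWin_card G)
    calc (copNumber G : ℝ) ≤ X.ncard := by exact_mod_cast h1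
      _ ≤ K * q ^ 2 := hX
      _ ≤ _ := by
        gcongr
        have : 0 < 24 / rate a₂ a₃ a₄ a₅ := by positivity
        linarith
  have hreach : ∀ u ∉ X, ∀ v ∉ X, G.Reachable u v := by
    obtain ⟨c, hc⟩ := hcomp
    intro u hu v hv
    exact SimpleGraph.ConnectedComponent.exact ((hc hu).trans (hc hv).symm)
  obtain ⟨t, ht1, ht2, ht⟩ := H.exists_final_radius
  obtain ⟨g, hg⟩ := H.exists_hall_team ht ht1 ht2
  obtain ⟨r₀, ρ, hr₀, hρ0, hρm, hρ⟩ := H.exists_radii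
  obtain ⟨M, hM1, hM2⟩ := exists_nat_pow_near (x := y ^ 6) (y := 4)
    (one_le_pow₀ (by linarith)) (by norm_num)
  set C := 6 / rate a₂ a₃ a₄ a₅ with hC
  have hC0 : 0 < C := by positivity
  have hw := H.radius_window hr₀ (i := 0) (by simpa using one_le_pow₀ (by linarith))
    (hρ 0).1 (r := r₀) le_rfl (by omega)
  obtain ⟨s, h, hs, hwin⟩ := H.exists_teams ht1 ht2 hg hr₀ hρm hρ hM1 hM2.le
    (m := fun i => ⌈C * (3 / 4) ^ i * q ^ 2⌉₊) (fun i => Nat.le_ceil _) M 0 (by omega) r₀ le_rfl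
    -- Before round 0 nothing but X is guarded, and there is one position for each start of the
    -- robber.
    (by omega) ((fun v => (v, sphere G {v} r₀ \ X)) '' Xᶜ) (by
      refine (Set.ncard_image_le (Set.toFinite _)).trans ?_
      simpa using Set.ncard_le_card (Xᶜ)) (by
      rintro _ ⟨v, hv, rfl⟩
      refine ⟨hv, subset_rfl, ?_⟩
      have h1 := (H.sphere_bounds hv (H.one_le_radius hw.1) (H.pow_mul_le hw.2)).2
      rw [pow_zero, div_one]
      refine le_trans ?_ h1
      exact_mod_cast Set.ncard_le_ncard Set.sdiff_subset (Set.toFinite _))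
  have hcop : copNumber G ≤ Nat.card ((X ⊕ Fin ⌈q ^ 2⌉₊) ⊕ (Fin ⌈q ^ 2⌉₊ ⊕ (Empty ⊕ Fin s))) := by
    refine copNumber_le_of_wins
      (Sum.elim (Sum.elim ((↑) : X → V) fun _ => x₀) (Sum.elim g (Sum.elim Empty.elim h)))
      fun v => ?_
    by_cases hv : v ∈ X
    · exact Wins.caught (Sum.inl (Sum.inl ⟨v, hv⟩)) rfl
    · refine hwin (v, sphere G {v} r₀ \ X) ⟨v, hv, rfl⟩ Empty (fun _ => x₀) Empty.elim Empty.elim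
        (fun _ => hreach _ hx₀ _ hv) (fun j => j.elim) ?_
      intro u hu
      by_cases huX : u ∈ X
      · exact Or.inl (Or.inl huX)
      · exact Or.inl (Or.inr ⟨hu, huX⟩)
  simp only [Nat.card_sum, Nat.card_coe_set_eq, Nat.card_eq_fintype_card, Fintype.card_fin,
    Fintype.card_sum, Fintype.card_empty, zero_add] at hcop
  have hceil : (⌈q ^ 2⌉₊ : ℝ) ≤ q ^ 2 + 1 := (Nat.ceil_lt_add_one (by positivity)).le
  have hM : (M : ℝ) ≤ q := by
    calc (M : ℝ) ≤ 4 ^ M := by exact_mod_cast (Nat.lt_pow_self (by norm_num : 1 < 4)).le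
      _ ≤ y ^ 6 := hM1
      _ ≤ q := H.pow_le_q (by norm_num)
  have hs' : (s : ℝ) ≤ 4 * C * q ^ 2 + q := by
    have hgeom : ∑ j ∈ Finset.range M, (3 / 4 : ℝ) ^ j ≤ 4 :=
      by
      rw [geom_sum_eq (by norm_num)]
      rw [div_le_iff_of_neg (by norm_num)]
      have : (0 : ℝ) ≤ (3 / 4) ^ M := by positivity
      linarith
    calc (s : ℝ) ≤ ∑ j ∈ Finset.range M, (⌈C * (3 / 4) ^ (0 + j) * q ^ 2⌉₊ : ℝ) := by
          exact_mod_cast hs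
      _ ≤ ∑ j ∈ Finset.range M, (C * q ^ 2 * (3 / 4) ^ j + 1) := by
          refine Finset.sum_le_sum fun j _ => ?_
          rw [zero_add]
          refine (Nat.ceil_lt_add_one (by positivity)).le.trans (le_of_eq ?_)
          ring
      _ = C * q ^ 2 * ∑ j ∈ Finset.range M, (3 / 4 : ℝ) ^ j + M := by
          rw [Finset.sum_add_distrib, ← Finset.mul_sum]; simp
      _ ≤ C * q ^ 2 * 4 + q := by gcongr
      _ = _ := by ring
  have hC24 : 24 / rate a₂ a₃ a₄ a₅ = 4 * C := by rw [hC]; ring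
  rw [hC24]
  calc (copNumber G : ℝ) ≤ (X.ncard + ⌈q ^ 2⌉₊ + (⌈q ^ 2⌉₊ + s) : ℕ) := by exact_mod_cast hcop
    _ = (X.ncard + ⌈q ^ 2⌉₊ + (⌈q ^ 2⌉₊ + s) : ℝ) := by push_cast; ring
    _ ≤ K * q ^ 2 + (q ^ 2 + 1) + ((q ^ 2 + 1) + (4 * C * q ^ 2 + q)) := by gcongr
    _ ≤ _ := by nlinarith

end Expands

end Expansion

/-! ### Large n, and the choice of the error parameter. -/

open Filter Asymptotics in
/-- The numerical conditions on `y = n ^ θ` hold for all large `n`. -/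
theorem eventually_conditions (J θ a₁ a₂ b : ℝ) (hθ : 0 < θ) (ha₁ : 0 < a₁) (ha₂ : 0 < a₂)
    (hb : 0 < b) :
    ∀ᶠ n : ℕ in atTop, 2 ≤ n ∧ Real.log n ^ J ≤ (n : ℝ) ^ θ ∧ 8 * a₂ ≤ (n : ℝ) ^ θ ∧
      8 ≤ (n : ℝ) ^ θ * a₂ ∧ b ≤ (n : ℝ) ^ θ ∧ 1 ≤ (n : ℝ) ^ θ * b ∧
      Real.log n ≤ (n : ℝ) ^ θ ∧ Real.exp (-(a₁ * (n : ℝ) ^ θ / 4)) * (4 * n) ≤ 1 := by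
  have hy : Tendsto (fun n : ℕ => (n : ℝ) ^ θ) atTop atTop :=
    (tendsto_rpow_atTop hθ).comp tendsto_natCast_atTop_atTop
  have hJ : ∀ᶠ n : ℕ in atTop, Real.log n ^ J ≤ (n : ℝ) ^ θ := by
    have h := (isLittleO_log_rpow_rpow_atTop J hθ).bound one_pos
    filter_upwards [tendsto_natCast_atTop_atTop.eventually h, eventually_ge_atTop 1] with n hn hn1
    have hlog : 0 ≤ Real.log n := Real.log_nonneg (by exact_mod_cast hn1)
    rw [one_mul, Real.norm_of_nonneg (by positivity), Real.norm_of_nonneg (by positivity)] at hn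
    exact hn
  have hlog : ∀ c : ℝ, 0 < c → ∀ᶠ n : ℕ in atTop, Real.log n ≤ c * (n : ℝ) ^ θ := fun c hc => by
    have h := (isLittleO_log_rpow_atTop hθ).bound hc
    filter_upwards [tendsto_natCast_atTop_atTop.eventually h, eventually_ge_atTop 1] with n hn hn1
    have hlog : 0 ≤ Real.log n := Real.log_nonneg (by exact_mod_cast hn1)
    rwa [Real.norm_of_nonneg hlog, Real.norm_of_nonneg (by positivity)] at hn
  filter_upwards [eventually_ge_atTop 2, hJ, hlog 1 one_pos, hlog (a₁ / 8) (by positivity),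
    hy.eventually_ge_atTop (8 * a₂), hy.eventually_ge_atTop (8 / a₂), hy.eventually_ge_atTop b,
    hy.eventually_ge_atTop (1 / b), hy.eventually_ge_atTop (8 * Real.log 4 / a₁)]
    with n h1 h2 h3 h4 h5 h6 h7 h8 h9
  rw [div_le_iff₀ (by positivity)] at h6 h8 h9
  refine ⟨h1, h2, h5, h6, h7, h8, by simpa using h3, ?_⟩
  have hn : (0 : ℝ) < n := by exact_mod_cast (by omega : 0 < n)
  calc Real.exp (-(a₁ * (n : ℝ) ^ θ / 4)) * (4 * n)
      = Real.exp (-(a₁ * (n : ℝ) ^ θ / 4) + (Real.log 4 + Real.log n)) := by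
        rw [Real.exp_add, Real.exp_add, Real.exp_log (by norm_num), Real.exp_log hn]
    _ ≤ 1 := by rw [Real.exp_le_one_iff]; linarith

theorem copNumber_le_sqrt_mul {V : Type*} [Finite V] (G : SimpleGraph V) {B : ℝ}
    (hB : (Nat.card V : ℝ) ≤ B) : (copNumber G : ℝ) ≤ √B * √(Nat.card V : ℝ) := by
  have h : (copNumber G : ℝ) ≤ Nat.card V := by exact_mod_cast Nat.sInf_le (copsWin_card G)
  calc (copNumber G : ℝ) ≤ √(Nat.card V : ℝ) * √(Nat.card V : ℝ) := by
        rwa [Real.mul_self_sqrt (Nat.cast_nonneg _)]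
    _ ≤ _ := by gcongr

end CopsRobber

theorem theorem3p1 (J δ a₁ a₂ a₃ a₄ a₅ K : ℝ) (hδ : 0 < δ)
    (ha₁ : 0 < a₁) (ha₂ : 0 < a₂) (ha₃ : 0 < a₃) (ha₄ : 0 < a₄) (ha₅ : 0 < a₅) :
    ∃ C : ℝ, 0 < C ∧
      ∀ (n : ℕ) (d : ℝ), 2 ≤ d → d < Real.log n ^ J →
      ∀ (V : Type*) [Finite V] (G : SimpleGraph V), Nat.card V = n →
      ∀ X : Set V, (X.ncard : ℝ) ≤ K * √(n : ℝ) →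
      -- (i) growth of spheres
      (∀ v : V, v ∉ X → ∀ r r' : ℕ,
        1 ≤ r → d ^ r < (n : ℝ) ^ (1 / 2 + δ) →
        1 ≤ r' → d ^ r' < (n : ℝ) ^ (1 / 2 + δ) →
        ∀ (V' : Set V) (k : ℕ), V' ⊆ ball G {v} r \ X → V'.ncard = k →
          (k : ℝ) * d ^ r' ≤ n / Real.log n ^ J →
          a₁ * k * d ^ r' ≤ ((sphere G V' r').ncard : ℝ) ∧
            ((sphere G V' r').ncard : ℝ) ≤ a₂ * k * d ^ r') →
      -- (ii) accessibility of unions of spheres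
      (∀ r r' : ℕ,
        (n : ℝ) ^ (1 / 4 - δ) < (d + 1) * d ^ r → (d + 1) * d ^ r < (n : ℝ) ^ (1 / 4 + δ) →
        (n : ℝ) ^ (1 / 4 - δ) < (d + 1) * d ^ r' → (d + 1) * d ^ r' < (n : ℝ) ^ (1 / 4 + δ) →
        ∀ v : V, v ∉ X → ∀ A U : Set V, A ⊆ sphere G {v} r \ X →
          U = ⋃ a ∈ A, sphere G {a} r' →
          (n : ℝ) ^ (1 / 4 - δ) < (A.ncard : ℝ) →
          d ^ (r + r') < a₃ * n / (U.ncard : ℝ) →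
          ∃ Q : Set V,
            (∀ a ∈ A, ((sphere G {a} r' ∩ Q).ncard : ℝ) < (n : ℝ) ^ (1 / 4 - 2 * δ)) ∧
            Accessible G d (r + r' + 1) a₄ a₅ (U \ Q)) →
      -- (iii) all vertices outside `X` lie in one component
      (∃ c : G.ConnectedComponent, Xᶜ ⊆ c.supp) →
      (copNumber G : ℝ) ≤ C * √(n : ℝ) := by
  -- For y = n^θ, the bound 1/80 gives y^20 ≤ n^{1/4}, and δ/10 gives y^10 ≤ n^δ, which fits all
  -- windows into those of the hypotheses.
  set θ : ℝ := min (δ / 10) (1 / 80) with hθdef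
  have hθ : 0 < θ := by positivity
  have hθδ : 10 * θ ≤ δ := by have := min_le_left (δ / 10) (1 / 80); linarith
  have hθ80 : 80 * θ ≤ 1 := by have := min_le_right (δ / 10) (1 / 80); linarith
  have hβ : 0 < √a₃ / a₂ := div_pos (Real.sqrt_pos.2 ha₃) ha₂
  obtain ⟨B, hB⟩ := Filter.eventually_atTop.1
    (eventually_conditions J θ a₁ a₂ (√a₃ / a₂) hθ ha₁ ha₂ hβ)
  have hrate : 0 < 24 / Expands.rate a₂ a₃ a₄ a₅ := by
    rw [Expands.rate]
    positivity
  -- The term `√B` settles the orders n < B, where c(G) ≤ n ≤ √B √n.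
  refine ⟨√B + |K| + 5 + 24 / Expands.rate a₂ a₃ a₄ a₅, by positivity, ?_⟩
  intro n d hd2 hdJ V _ G hn X hX hi hii hiii
  rcases lt_or_ge n B with hnB | hnB
  · have h := copNumber_le_sqrt_mul G (B := B) (by rw [hn]; exact_mod_cast hnB.le)
    rw [hn] at h
    refine h.trans ?_
    gcongr
    linarith [abs_nonneg K]
  obtain ⟨hn2, h1, h2, h3, h4, h5, h6, h7⟩ := hB n hnB
  have hn1 : (1 : ℝ) < n := by exact_mod_cast (by omega : 1 < n)
  have hn0 : (0 : ℝ) < n := by linarith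
  have hpow : ∀ (s e : ℝ) (k : ℕ), s * k = e → ((n : ℝ) ^ s) ^ k = (n : ℝ) ^ e := by
    rintro s e k rfl
    rw [Real.rpow_mul_natCast hn0.le]
  set q : ℝ := (n : ℝ) ^ (1 / 4 : ℝ) with hq
  set y : ℝ := (n : ℝ) ^ θ with hy
  have hq4 : q ^ 4 = n := by rw [hq, hpow _ 1 4 (by norm_num), Real.rpow_one]
  have hq2 : q ^ 2 = √(n : ℝ) := by
    rw [hq, hpow _ (1 / 2) 2 (by norm_num), Real.sqrt_eq_rpow]
  have hq0 : 0 < q := by positivity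
  have hy0 : 0 < y := by positivity
  have hdy : d ≤ y := hdJ.le.trans h1
  have hy2 : 2 ≤ y := hd2.trans hdy
  have hJ0 : 0 < Real.log n ^ J := by linarith
  have hyk : ∀ k : ℕ, y ^ k = (n : ℝ) ^ (θ * k) := fun k => hpow _ _ _ rfl
  have hlow : (n : ℝ) ^ (1 / 4 - δ) * y ^ 9 < q := by
    rw [hyk, hq, ← Real.rpow_add hn0]
    exact Real.rpow_lt_rpow_of_exponent_lt hn1 (by push_cast; linarith)
  have hup : q * y ^ 9 < (n : ℝ) ^ (1 / 4 + δ) := by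
    rw [hyk, hq, ← Real.rpow_add hn0]
    exact Real.rpow_lt_rpow_of_exponent_lt hn1 (by push_cast; linarith)
  have hup' : q ^ 2 * y ^ 3 < (n : ℝ) ^ (1 / 2 + δ) := by
    rw [hyk, hq, hpow _ (1 / 2) 2 (by norm_num), ← Real.rpow_add hn0]
    exact Real.rpow_lt_rpow_of_exponent_lt hn1 (by push_cast; linarith)
  have hQ : y ^ 10 * (n : ℝ) ^ (1 / 4 - 2 * δ) ≤ q := by
    rw [hyk, hq, ← Real.rpow_add hn0]
    exact Real.rpow_le_rpow_of_exponent_le hn1.le (by push_cast; linarith)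
  have hlow' : ∀ {x : ℝ} {k : ℕ}, k ≤ 9 → q ≤ y ^ k * x → (n : ℝ) ^ (1 / 4 - δ) < x := by
    intro x k hk hx
    have hyk9 : y ^ k ≤ y ^ 9 := pow_le_pow_right₀ (by linarith) hk
    have h8 : 0 < (n : ℝ) ^ (1 / 4 - δ) := by positivity
    have h9 : y ^ k * (n : ℝ) ^ (1 / 4 - δ) < y ^ k * x :=
      calc y ^ k * (n : ℝ) ^ (1 / 4 - δ) ≤ y ^ 9 * (n : ℝ) ^ (1 / 4 - δ) := by gcongr
        _ < q := by rw [mul_comm]; exact hlow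
        _ ≤ _ := hx
    exact lt_of_mul_lt_mul_left h9 (by positivity)
  have hwin : ∀ r : ℕ, q ≤ y ^ 2 * d ^ r → d ^ r ≤ q * y ^ 6 →
      (n : ℝ) ^ (1 / 4 - δ) < (d + 1) * d ^ r ∧ (d + 1) * d ^ r < (n : ℝ) ^ (1 / 4 + δ) := by
    intro r hr1 hr2
    have hdr : 0 < d ^ r := by positivity
    refine ⟨(hlow' (by norm_num) hr1).trans_le (by nlinarith), lt_of_le_of_lt ?_ hup⟩
    calc (d + 1) * d ^ r ≤ (y * y) * (q * y ^ 6) := by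
          gcongr
          nlinarith
      _ = q * y ^ 8 := by ring
      _ ≤ q * y ^ 9 := by gcongr <;> linarith
  have H : Expands G X d q y a₁ a₂ a₃ a₄ a₅ :=
    { card_eq := by rw [hn, hq4]
      two_le := hd2
      d_le := hdy
      pow_le := by
        rw [hyk, hq]
        exact Real.rpow_le_rpow_of_exponent_le hn1.le (by push_cast; linarith)
      a₁_pos := ha₁
      a₂_pos := ha₂
      a₃_pos := ha₃
      a₄_pos := ha₄
      a₅_pos := ha₅
      a₂_le := h2
      le_a₂ := h3
      ratio_le := h4
      le_ratio := h5
      log_le := by rw [hq4]; exact h6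
      exp_le := by rw [hq4]; exact h7
      growth := fun v hv r r' hr hdr hr' hdr' V' hV' hk =>
        hi v hv r r' hr (hdr.trans_lt hup') hr' (hdr'.trans_lt hup') V' _ hV' rfl (by
          rw [le_div_iff₀ hJ0]
          rw [hq4] at hk
          refine le_trans ?_ hk
          gcongr)
      accessible := fun r r' hr1 hr2 hr1' hr2' v hv A hA hAq hU => by
        rw [hq4] at hU
        obtain ⟨Q, hQ1, hQ2⟩ := hii r r' (hwin r hr1 hr2).1 (hwin r hr1 hr2).2 (hwin r' hr1' hr2').1
          (hwin r' hr1' hr2').2 v hv A _ hA rfl (hlow' (by norm_num) hAq) hU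
        refine ⟨Q, fun a ha => le_trans ?_ hQ, hQ2⟩
        gcongr
        exact (hQ1 a ha).le }
  have h8 := H.copNumber_le (K := K) (by rw [hq2]; exact hX) hiii
  rw [hq2] at h8
  refine h8.trans ?_
  gcongr
  linarith [Real.sqrt_nonneg (B : ℝ), le_abs_self K]
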